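/- Let $K$ be a commutative ring and $t\in K$. Let $\widehat\Lambda$ be the ring of all symmetric formal power series in $x_1,x_2,\dots$ over $K$, and let $\Lambda\subset\widehat\Lambda$ be the subring of those of bounded degree. Let $(\,,)\colon\widehat\Lambda\times\Lambda\to K$ be the Hall inner product, i.e. $(\sum_\lambda A_\lambda s_\lambda,\sum_\lambda B_\lambda s_\lambda)=\sum_\lambda A_\lambda B_\lambda$, where the $s_\lambda$ are the Schur functions, the first sum may be infinite and the second is finite. Let $\Delta\colon\Lambda\to\Lambda\otimes\Lambda$, $f\mapsto f(x,y)=f(x_1,x_2,\dots,y_1,y_2,\dots)$, be the coproduct, and for $F\in\widehat\Lambda$ let $F^\perp=((F,-)\otimes\mathrm{id})\circ\Delta\colon\Lambda\to\Lambda$. Let $H(t)=\sum_{i\ge0}t^ih_i\in\widehat\Lambda$, where $h_i$ is the $i$-th complete homogeneous symmetric function. For partitions $\mu\subset\lambda$ let $g_{\lambda/\mu}=\sum_T\prod_i x_i^{T(i)}$ be the dual stable Grothendieck polynomial, where $T$ runs over the reverse plane partitions of shape $\lambda/\mu$ (fillings of the boxes of $\lambda/\mu$ with positive integers that increase weakly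 along rows and columns) and $T(i)$ is the number of columns of $T$ that contain $i$; put $g_\lambda=g_{\lambda/\emptyset}$. Let $c(\lambda/\mu)$ be the number of columns of $\lambda/\mu$ that contain a box, and $c(\lambda)=c(\lambda/\emptyset)$. Then $H(t)^\perp\colon\Lambda\to\Lambda$ is a $K$-algebra automorphism, every $g_{\lambda/\mu}$ lies in $\Lambda$, and: (1) $H(t)^\perp(f)=f(t,x_1,x_2,\dots)$ for every $f\in\Lambda$. (2) For all partitions $\mu\subset\lambda$, $$H(t)^\perp(g_{\lambda/\mu})=\sum_{\mu\subset\nu\subset\lambda}t^{c(\lambda/\nu)}g_{\nu/\mu}=\sum_{\mu\subset\nu\subset\lambda}t^{c(\nu/\mu)}g_{\lambda/\nu},$$ and in particular, for every partition $\lambda$, $$H(t)^\perp(g_{\lambda})=\sum_{\nu\subset\lambda}t^{c(\lambda/\nu)}g_{\nu}=\sum_{\nu\subset\lambda}t^{c(\nu)}g_{\lambda/\nu}.$$ -/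

import Mathlib

open scoped TensorProduct

namespace SymFun

/-! ### Symmetric power series and symmetric functions

The variables `x₁, x₂, …` are indexed by `ℕ`, so `x_{i+1}` is `MvPowerSeries.X i`. -/

section Ring

variable (K : Type*) [CommRing K]

/-- The completed ring of symmetric functions: all symmetric formal power series in
`x₁, x₂, …`, i.e. the power series invariant under every permutation of the variables. -/
noncomputable def SymSeries : Subalgebra K (MvPowerSeries ℕ K) :=
  ⨅ σ : Equiv.Perm ℕ,
    AlgHom.equalizer (MvPowerSeries.rename (R := K) σ) (AlgHom.id K (MvPowerSeries ℕ K))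

/-- `f` has bounded degree: for some `d`, no monomial of degree greater than `d` occurs in it. -/
def BoundedDegree {K : Type*} [CommRing K] (f : MvPowerSeries ℕ K) : Prop :=
  ∃ d : ℕ, ∀ n : ℕ →₀ ℕ, d < n.degree → MvPowerSeries.coeff n f = 0

/-- The ring of symmetric functions: symmetric power series of bounded degree. -/
noncomputable def Sym : Subalgebra K (MvPowerSeries ℕ K) where
  carrier := {f | f ∈ SymSeries K ∧ BoundedDegree f}
  mul_mem' := by
    rintro f g ⟨hf, d, hd⟩ ⟨hg, e, he⟩
    refine ⟨mul_mem hf hg, d + e, fun n hn => ?_⟩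
    classical
    rw [MvPowerSeries.coeff_mul]
    refine Finset.sum_eq_zero fun p hp => ?_
    have h : p.1.degree + p.2.degree = n.degree := by
      rw [← map_add, Finset.HasAntidiagonal.mem_antidiagonal.mp hp]
    rcases Nat.lt_or_ge d p.1.degree with h1 | h1
    · rw [hd _ h1, zero_mul]
    · rw [he p.2 (by omega), mul_zero]
  add_mem' := by
    rintro f g ⟨hf, d, hd⟩ ⟨hg, e, he⟩
    refine ⟨add_mem hf hg, d + e, fun n hn => ?_⟩
    rw [map_add, hd n (by omega), he n (by omega), add_zero]
  algebraMap_mem' := by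
    intro r
    refine ⟨algebraMap_mem _ r, 0, fun n hn => ?_⟩
    classical
    rw [MvPowerSeries.algebraMap_apply, MvPowerSeries.coeff_C, if_neg]
    rintro rfl
    simp at hn

/-- The complete homogeneous symmetric function `h_i`: the sum of all monomials of degree `i`. -/
noncomputable def complete (i : ℕ) : MvPowerSeries ℕ K :=
  fun n => if n.degree = i then 1 else 0

/-- The power series `∑_{i ≥ 0} t^i h_i` (for every monomial the sum of the coefficients is
finite). -/
noncomputable def completeSeries {K : Type*} [CommRing K] (t : K) : MvPowerSeries ℕ K :=
  fun n => ∑ᶠ i : ℕ, t ^ i * MvPowerSeries.coeff n (complete K i)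

theorem completeSeries_coeff {K : Type*} [CommRing K] (t : K) (n : ℕ →₀ ℕ) :
    MvPowerSeries.coeff n (completeSeries t) = t ^ n.degree := by
  change (∑ᶠ i : ℕ, t ^ i * (if n.degree = i then (1 : K) else 0)) = _
  rw [finsum_eq_single _ n.degree]
  · simp
  · intro i hi
    rw [if_neg (Ne.symm hi), mul_zero]

theorem completeSeries_mem {K : Type*} [CommRing K] (t : K) :
    completeSeries t ∈ SymSeries K := by
  rw [SymSeries, Algebra.mem_iInf]
  intro σ
  rw [AlgHom.mem_equalizer]
  ext n
  obtain ⟨m, rfl⟩ : ∃ m : ℕ →₀ ℕ, m.embDomain σ.toEmbedding = n :=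
    ⟨n.embDomain σ.symm.toEmbedding, by
      ext i
      obtain ⟨j, rfl⟩ := σ.surjective i
      have h1 := Finsupp.embDomain_apply_self σ.toEmbedding
        (n.embDomain σ.symm.toEmbedding) j
      have h2 := Finsupp.embDomain_apply_self σ.symm.toEmbedding n (σ j)
      simp only [Equiv.coe_toEmbedding, Equiv.symm_apply_apply] at h1 h2
      rw [h1, h2]⟩
  have h := MvPowerSeries.coeff_embDomain_rename σ.toEmbedding (completeSeries t) m
  simp only [AlgHom.coe_id, id_eq]
  refine (Eq.trans ?_ h).trans ?_
  · rfl
  · rw [completeSeries_coeff, completeSeries_coeff]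
    congr 1
    rw [Finsupp.embDomain_eq_mapDomain, Finsupp.degree_mapDomain]

/-- The element `H(t) = ∑_{i ≥ 0} t^i h_i` of the completed ring of symmetric functions. -/
noncomputable def H {K : Type*} [CommRing K] (t : K) : SymSeries K :=
  ⟨completeSeries t, completeSeries_mem t⟩

/-- The substitution `f(x₁, x₂, …) ↦ f(t, x₁, x₂, …)`. The coefficient of `x^n` in the result
is `∑_k t^k a_k`, where `a_k` is the coefficient in `f` of the monomial `x₁^k · (x^n with every
variable shifted by one)`; the sum is finite if `f` has bounded degree. -/
noncomputable def substFirst {K : Type*} [CommRing K] (t : K) (f : MvPowerSeries ℕ K) :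
    MvPowerSeries ℕ K :=
  fun n => ∑ᶠ k : ℕ, t ^ k *
    MvPowerSeries.coeff (Finsupp.single 0 k + n.mapDomain Nat.succ) f

end Ring

/-! ### Schur functions and the Hall inner product -/

section Hall

variable (K : Type*) [CommRing K]

/-- The content of a semistandard tableau: the multiplicity of every entry. -/
noncomputable def content {lam : YoungDiagram} (T : SemistandardYoungTableau lam) : ℕ →₀ ℕ :=
  ∑ c ∈ lam.cells, Finsupp.single (T c.1 c.2) 1

/-- The Schur function `s_λ`, the generating function of the semistandard tableaux of
shape `λ`. -/
noncomputable def schur (lam : YoungDiagram) : MvPowerSeries ℕ K :=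
  fun n => (Nat.card {T : SemistandardYoungTableau lam // content T = n} : K)

/-- The (possibly infinite) linear combination `∑_λ A_λ s_λ` (for every monomial the sum of the
coefficients is finite, since `s_λ` is homogeneous of degree `|λ|`). -/
noncomputable def schurSum {K : Type*} [CommRing K] (A : YoungDiagram → K) : MvPowerSeries ℕ K :=
  fun n => ∑ᶠ lam : YoungDiagram, A lam * MvPowerSeries.coeff n (schur K lam)

open Classical in
/-- The coefficients `A_λ` in the expansion `F = ∑_λ A_λ s_λ` of a symmetric power series. (The
expansion exists and is unique for symmetric `F`, so that `else` never applies to those.) -/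
noncomputable def schurCoeff {K : Type*} [CommRing K] (F : MvPowerSeries ℕ K) :
    YoungDiagram → K :=
  if h : ∃ A : YoungDiagram → K, schurSum A = F then h.choose else 0

/-- The Hall inner product `(F, f)` of a symmetric power series and a symmetric function: the
bilinear pairing in which the Schur functions are orthonormal, i.e. `(F, f) = ∑_λ A_λ B_λ` for
`F = ∑_λ A_λ s_λ` and `f = ∑_λ B_λ s_λ`, the second sum being finite. -/
noncomputable def hall {K : Type*} [CommRing K] (F : SymSeries K) (f : Sym K) : K :=
  ∑ᶠ lam : YoungDiagram,
    schurCoeff (F : MvPowerSeries ℕ K) lam * schurCoeff (f : MvPowerSeries ℕ K) lam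

open Classical in
/-- The map `f ↦ (F, f)`, bundled as a linear map. (It is linear, so `else` never applies.) -/
noncomputable def hallLin {K : Type*} [CommRing K] (F : SymSeries K) : Sym K →ₗ[K] K :=
  if h : IsLinearMap K (hall F) then h.mk' (hall F) else 0

end Hall

/-! ### The coproduct and the operators `F^⊥` -/

section Coproduct

variable (K : Type*) [CommRing K]

/-- The canonical map from `Λ(x) ⊗ Λ(y)` to the power series in the two sets of variables
`x = (X (inl i))_i` and `y = (X (inr i))_i`, taking `a ⊗ b` to `a(x) b(y)`. -/
noncomputable def tensorToSeries : Sym K ⊗[K] Sym K →ₐ[K] MvPowerSeries (ℕ ⊕ ℕ) K :=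
  Algebra.TensorProduct.productMap
    ((MvPowerSeries.rename (R := K) (Function.Embedding.inl : ℕ ↪ ℕ ⊕ ℕ)).comp (Sym K).val)
    ((MvPowerSeries.rename (R := K) (Function.Embedding.inr : ℕ ↪ ℕ ⊕ ℕ)).comp (Sym K).val)

/-- The power series `f(x, y) = f(x₁, x₂, …, y₁, y₂, …)` for symmetric `f`: the variables of `f`
are listed as `x`'s and `y`'s by some bijection, whose choice does not matter. -/
noncomputable def twoAlphabets {K : Type*} [CommRing K] (f : MvPowerSeries ℕ K) :
    MvPowerSeries (ℕ ⊕ ℕ) K :=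
  MvPowerSeries.rename (R := K) Equiv.natSumNatEquivNat.symm f

open Classical in
/-- The coproduct `Δ` of the ring of symmetric functions: `Δ f` is the element of `Λ ⊗ Λ` which
is `f(x, y)` as a power series in `x` and `y`. (There is exactly one such element, so `else` never
applies.) -/
noncomputable def coproduct {K : Type*} [CommRing K] (f : Sym K) : Sym K ⊗[K] Sym K :=
  if h : ∃ T : Sym K ⊗[K] Sym K, tensorToSeries K T = twoAlphabets (f : MvPowerSeries ℕ K)
  then h.choose else 0

/-- The operator `F^⊥ = ((F, -) ⊗ id) ∘ Δ`, that is `F^⊥ f = ∑ (F, f₁) f₂` where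
`Δ f = ∑ f₁ ⊗ f₂`. -/
noncomputable def perp {K : Type*} [CommRing K] (F : SymSeries K) (f : Sym K) : Sym K :=
  TensorProduct.lid K (Sym K) ((hallLin F).rTensor (Sym K) (coproduct f))

end Coproduct

/-! ### Dual stable Grothendieck polynomials

A partition is a `YoungDiagram`, whose cells are the pairs (row, column), and containment of
partitions is `≤`. -/

section Grothendieck

/-- The boxes of the skew shape `λ/μ`. -/
def skewCells (lam mu : YoungDiagram) : Finset (ℕ × ℕ) := lam.cells \ mu.cells

/-- The number `c(λ/μ)` of columns of the skew shape `λ/μ`, i.e. of columns that contain a box. -/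
def numCols (lam mu : YoungDiagram) : ℕ := ((skewCells lam mu).image Prod.snd).card

/-- A reverse plane partition of shape `λ/μ`: a filling of the boxes that is weakly increasing
along every row and down every column. The entry `i : ℕ` stands for the positive integer
`i + 1`. -/
structure RPP (lam mu : YoungDiagram) where
  entry : {c : ℕ × ℕ // c ∈ skewCells lam mu} → ℕ
  row_weak : ∀ c d, c.1.1 = d.1.1 → c.1.2 ≤ d.1.2 → entry c ≤ entry d
  col_weak : ∀ c d, c.1.2 = d.1.2 → c.1.1 ≤ d.1.1 → entry c ≤ entry d

/-- The pairs (entry, column) such that the entry occurs in the column. -/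
def RPP.entryCols {lam mu : YoungDiagram} (T : RPP lam mu) : Finset (ℕ × ℕ) :=
  Finset.univ.image fun c : {c : ℕ × ℕ // c ∈ skewCells lam mu} => (T.entry c, c.1.2)

/-- The exponent of `x^T = ∏_i x_i^{T(i)}`, where `T(i)` is the number of columns of `T` that
contain `i`. -/
noncomputable def RPP.weight {lam mu : YoungDiagram} (T : RPP lam mu) : ℕ →₀ ℕ :=
  ∑ p ∈ T.entryCols, Finsupp.single p.1 1

theorem RPP.weight_apply {lam mu : YoungDiagram} (T : RPP lam mu) (i : ℕ) :
    T.weight i = (T.entryCols.filter fun p => p.1 = i).card := by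
  rw [RPP.weight, Finsupp.finsetSum_apply, Finset.card_filter]
  exact Finset.sum_congr rfl fun p _ => Finsupp.single_apply

/-- The dual stable Grothendieck polynomial `g_{λ/μ} = ∑_T x^T`, summed over the reverse plane
partitions of shape `λ/μ`. -/
noncomputable def dualGroth (K : Type*) [CommRing K] (lam mu : YoungDiagram) :
    MvPowerSeries ℕ K :=
  fun n => (Nat.card {T : RPP lam mu // T.weight = n} : K)

theorem finite_between (mu lam : YoungDiagram) :
    {nu : YoungDiagram | mu ≤ nu ∧ nu ≤ lam}.Finite := by
  refine Set.Finite.of_finite_image (f := YoungDiagram.cells)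
    (Set.Finite.subset lam.cells.powerset.finite_toSet ?_) ?_
  · rintro _ ⟨nu, ⟨-, h⟩, rfl⟩
    exact Finset.mem_coe.mpr (Finset.mem_powerset.mpr (YoungDiagram.cells_subset_iff.mpr h))
  · intro a _ b _ h
    exact YoungDiagram.ext h

/-- The finite set of the partitions `ν` with `μ ⊂ ν ⊂ λ`. -/
noncomputable def between (mu lam : YoungDiagram) : Finset YoungDiagram :=
  (finite_between mu lam).toFinset

end Grothendieck

end SymFun

/-! A reverse plane partition of shape λ/μ is a chain of partitions from μ to λ: the boxes with
entry i form one link, and its contribution is x_i to the number of nonempty columns of that link.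
So the coefficient of x^n in g_{λ/μ} is an entry of the product U_{n_1} U_{n_2} ⋯, where U_k joins ν
to κ ⊇ ν if κ/ν has exactly k nonempty columns (`coeff_dualGroth`). If the U_k commute
(`card_colStep_comm`), the order of the links is irrelevant. This makes g_{λ/μ} symmetric, and it
proves both expansions of g_{λ/μ}(t, x_1, …): the link that belongs to t may be made the last of the
chain or the first (`substFirst_dualGroth_left`, `substFirst_dualGroth_right`).

The U_k commute because ∑ x^k U_k factors over columns. On functions of partitions it is a product
of operators 1 + x (D_j + D_j² + ⋯), where D_j removes a box from column j. The D_j commute at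
distance at least 2, and D_{j+1} D_j commutes with D_j and with D_{j+1}. These local relations make
the products with parameters x and y commute (`commute_geometric`, `commute_descProd`,
`commute_columns`). The factors 1 + x D_j give the same for horizontal strips (`commute_strips`),
hence the symmetry of Schur functions.

For the operator H(t)^⊥, Schur functions are unitriangular against the monomials whose exponents are
partitions, so every symmetric series has exactly one Schur expansion (`exists_schurSum`,
`schurSum_injective`). Since s_{(k)} = h_k, and x_1^k occurs only in the Schur function s_{(k)}, the
pairing is (H(t), f) = f(t, 0, 0, …) (`hall_H`). Applied to the first alphabet of f(x, y), this
gives H(t)^⊥ f = f(t, y) (`perp_H`). This substitution is multiplicative, and it alters f only below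
its top degree, so it is bijective by induction on the degree. -/

namespace SymFun

/-! ### Commuting products in a noncommutative ring -/

section Commute

/-- The product `A (n - 1) * ⋯ * A 1 * A 0`. -/
def descProd {E : Type*} [Ring E] (A : ℕ → E) : ℕ → E
  | 0 => 1
  | n + 1 => A n * descProd A n

theorem commute_descProd_left {E : Type*} [Ring E] {A : ℕ → E} {b : E} {n : ℕ}
    (h : ∀ i < n, Commute (A i) b) : Commute (descProd A n) b := by
  induction n with
  | zero => exact Commute.one_left _
  | succ n ih => exact (h n (by omega)).mul_left (ih fun i hi => h i (by omega))

/-- Neighbouring factors `A (i + 1)` and `B i` need not commute; only products of two neighbours do.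
Invertibility makes it possible to glue overlapping pairs. -/
theorem commute_descProd {E : Type*} [Ring E] {A B : ℕ → E}
    (hA : ∀ i, IsUnit (A i)) (hB : ∀ i, IsUnit (B i)) (same : ∀ i, Commute (A i) (B i))
    (farA : ∀ i j, i + 2 ≤ j → Commute (A i) (B j))
    (farB : ∀ i j, i + 2 ≤ j → Commute (B i) (A j))
    (near : ∀ i, Commute (A (i + 1) * A i) (B (i + 1) * B i)) (n : ℕ) :
    Commute (descProd A n) (descProd B n) := by
  -- The step goes from length `n + 1` to `n + 2`, since it needs a pair of neighbours; carrying two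
  -- lengths puts 0 and 1 into the base case.
  suffices h : Commute (descProd A n) (descProd B n) ∧
      Commute (descProd A (n + 1)) (descProd B (n + 1)) from h.1
  induction n with
  | zero =>
    refine ⟨Commute.one_left _, ?_⟩
    simpa [descProd] using same 0
  | succ n ih =>
    refine ⟨ih.2, ?_⟩
    obtain ⟨a, ha⟩ := hA n
    obtain ⟨b, hb⟩ := hB n
    have hab : Commute a b := by
      have := same n
      rw [← ha, ← hb] at this
      exact Commute.units_of_val this
    have hinv : (↑a⁻¹ : E) * ↑b⁻¹ = ↑b⁻¹ * ↑a⁻¹ := by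
      have := (hab.inv_inv).eq
      exact_mod_cast congrArg Units.val this
    -- The factors of index `n` occur both in the top pair and in the products of length `n + 1`;
    -- `b⁻¹ * a⁻¹` cancels the duplicates. Exchanging `A` and `B` then only permutes commuting
    -- elements within each bracket.
    have key : ∀ (A B : ℕ → E) (a b : Eˣ), (a : E) = A n → (b : E) = B n →
        Commute (descProd A n) (B (n + 1)) →
        descProd A (n + 2) * descProd B (n + 2) =
          (A (n + 1) * A n * (B (n + 1) * B n)) * (↑b⁻¹ * ↑a⁻¹) *
            (descProd A (n + 1) * descProd B (n + 1)) := by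
      intro A B a b ha hb hc
      simp only [descProd, ← ha, ← hb]
      calc A (n + 1) * (↑a * descProd A n) * (B (n + 1) * (↑b * descProd B n))
          = A (n + 1) * ↑a * (descProd A n * B (n + 1)) * (↑b * descProd B n) := by
            simp only [mul_assoc]
        _ = A (n + 1) * ↑a * (B (n + 1) * descProd A n) * (↑b * descProd B n) := by rw [hc.eq]
        _ = _ := by simp only [mul_assoc, Units.mul_inv_cancel_left, Units.inv_mul_cancel_left]
    have e1 := key A B a b ha hb (commute_descProd_left fun i hi => farA i _ (by omega))
    have e2 := key B A b a hb ha (commute_descProd_left fun i hi => farB i _ (by omega))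
    change _ = _
    rw [e1, e2, (near n).eq, ih.2.eq, hinv]

theorem commute_inverse_one_sub {E : Type*} [Ring E] {b c p : E} (hp : (1 - b) * p = 1)
    (hp' : p * (1 - b) = 1) (cb : Commute c b) : Commute c p := by
  have h1 : Commute c (1 - b) := (Commute.one_right _).sub_right cb
  change _ = _
  calc c * p = p * (1 - b) * (c * p) := by rw [hp', one_mul]
    _ = p * ((1 - b) * c) * p := by simp only [mul_assoc]
    _ = p * c * ((1 - b) * p) := by rw [← h1.eq]; simp only [mul_assoc]
    _ = p * c := by rw [hp, mul_one]

/-- A product of the generating functions `1 + x (b + b² + ⋯)` and `1 + x (a + a² + ⋯)`, where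
`p` and `q` are the inverses of `1 - b` and `1 - a`. -/
theorem geometric_mul_geometric {R E : Type*} [CommRing R] [Ring E] [Algebra R E] {a b p q : E}
    (hp : (1 - b) * p = 1) (hp' : p * (1 - b) = 1) (hq : (1 - a) * q = 1)
    (cb : Commute (b * a) b) (x : R) :
    (1 + x • (b * p)) * (1 + x • (a * q)) =
      (1 - x) • (1 : E) + x • (p * q) - (x * (1 - x)) • (b * a * (p * q)) := by
  have cp : Commute (b * a) p := commute_inverse_one_sub hp hp' cb
  have e1 : b * p = p - 1 := by rw [sub_mul, one_mul] at hp; rw [← hp]; abel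
  have e1' : p * b = p - 1 := by rw [mul_sub, mul_one] at hp'; rw [← hp']; abel
  have e2 : a * q = q - 1 := by rw [sub_mul, one_mul] at hq; rw [← hq]; abel
  -- Here `a` and `b` do not commute, so `b * a` passes `p` as a whole; then `p * b` and `a * q`
  -- collapse to `p - 1` and `q - 1`.
  have e3 : b * a * (p * q) = p * q - p - q + 1 := by
    calc b * a * (p * q) = (b * a * p) * q := by simp only [mul_assoc]
      _ = (p * b) * (a * q) := by rw [cp.eq]; simp only [mul_assoc]
      _ = (p - 1) * (q - 1) := by rw [e1', e2]
      _ = _ := by noncomm_ring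
  rw [e3, e1, e2]
  simp only [mul_add, add_mul, mul_sub, sub_mul, one_mul, mul_one, smul_mul_assoc,
    mul_smul_comm, smul_sub, smul_add, sub_smul, mul_smul, one_smul]
  abel

/-- For every parameter the product is a combination of `1`, `p * q` and `b * a * (p * q)`, and
these three commute because `b * a` commutes with `p` and `q`. -/
theorem commute_geometric {R E : Type*} [CommRing R] [Ring E] [Algebra R E] {a b p q : E}
    (hp : (1 - b) * p = 1) (hp' : p * (1 - b) = 1) (hq : (1 - a) * q = 1)
    (hq' : q * (1 - a) = 1)
    (ca : Commute (b * a) a) (cb : Commute (b * a) b) (x y : R) :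
    Commute ((1 + x • (b * p)) * (1 + x • (a * q))) ((1 + y • (b * p)) * (1 + y • (a * q))) := by
  have c1 : Commute (b * a) (p * q) :=
    (commute_inverse_one_sub hp hp' cb).mul_right (commute_inverse_one_sub hq hq' ca)
  have c2 : Commute (p * q) (b * a * (p * q)) := c1.symm.mul_right (Commute.refl _)
  rw [geometric_mul_geometric hp hp' hq cb x, geometric_mul_geometric hp hp' hq cb y]
  refine Commute.sub_left (Commute.add_left ?_ ?_) ?_ <;>
    refine Commute.sub_right (Commute.add_right ?_ ?_) ?_ <;>
    refine Commute.smul_left (Commute.smul_right ?_ _) _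
  exacts [.refl _, .one_left _, .one_left _, .one_right _, .refl _, c2, .one_right _, c2.symm,
    .refl _]

end Commute

/-! ### Shortening the columns of a Young diagram -/

section Columns

theorem colLen_injective {lam mu : YoungDiagram} (h : ∀ j, lam.colLen j = mu.colLen j) :
    lam = mu := by
  ext ⟨i, j⟩
  rw [YoungDiagram.mem_cells, YoungDiagram.mem_cells, YoungDiagram.mem_iff_lt_colLen,
    YoungDiagram.mem_iff_lt_colLen, h]

theorem le_iff_colLen_le {lam mu : YoungDiagram} :
    mu ≤ lam ↔ ∀ j, mu.colLen j ≤ lam.colLen j := by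
  constructor
  · intro h j
    by_contra! hlt
    have := h (YoungDiagram.mem_iff_lt_colLen.mpr hlt)
    exact lt_irrefl _ (YoungDiagram.mem_iff_lt_colLen.mp this)
  · rintro h ⟨i, j⟩ hc
    exact YoungDiagram.mem_iff_lt_colLen.mpr ((YoungDiagram.mem_iff_lt_colLen.mp hc).trans_le (h j))

theorem eq_colLen_of_mem_iff {lam : YoungDiagram} {j m : ℕ} (h : ∀ i, (i, j) ∈ lam ↔ i < m) :
    lam.colLen j = m := by
  have h1 := (h m).not.mpr (lt_irrefl _)
  rw [YoungDiagram.mem_iff_lt_colLen, not_lt] at h1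
  by_contra hne
  have := (h (lam.colLen j)).mpr (lt_of_le_of_ne h1 hne)
  exact lt_irrefl _ (YoungDiagram.mem_iff_lt_colLen.mp this)

/-- The diagram `lam` with the `j`-th column shortened to length `a`, or to the length of the next
column if that is larger. -/
def setCol (lam : YoungDiagram) (j a : ℕ) : YoungDiagram where
  cells := lam.cells.filter fun c => c.2 = j → c.1 < max a (lam.colLen (j + 1))
  isLowerSet := by
    rintro ⟨i, k⟩ ⟨i', k'⟩ ⟨h1, h2⟩ hc
    simp only [Finset.coe_filter, Set.mem_ofPred_eq, YoungDiagram.mem_cells] at hc ⊢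
    simp only at h1 h2
    refine ⟨lam.up_left_mem h1 h2 hc.1, fun hk => ?_⟩
    by_cases hkj : k = j
    · exact lt_of_le_of_lt h1 (hc.2 hkj)
    · have := YoungDiagram.mem_iff_lt_colLen.mp
        (lam.up_left_mem h1 (show j + 1 ≤ k by omega) hc.1)
      omega

theorem colLen_setCol (lam : YoungDiagram) (j a i : ℕ) :
    (setCol lam j a).colLen i =
      if i = j then min (lam.colLen j) (max a (lam.colLen (j + 1))) else lam.colLen i := by
  apply eq_colLen_of_mem_iff
  intro r
  rw [← YoungDiagram.mem_cells]
  simp only [setCol, Finset.mem_filter, YoungDiagram.mem_cells, YoungDiagram.mem_iff_lt_colLen]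
  split_ifs with h
  · subst h
    simp
  · simp [h]

variable {R : Type*} [CommRing R]

/-- The operator that removes a box from the `j`-th column. -/
def removeBox (R : Type*) [CommRing R] (j : ℕ) : Module.End R (YoungDiagram → R) where
  toFun φ lam :=
    if lam.colLen (j + 1) < lam.colLen j then φ (setCol lam j (lam.colLen j - 1)) else 0
  map_add' φ ψ := by ext lam; simp only [Pi.add_apply]; split_ifs <;> simp
  map_smul' r φ := by ext lam; simp only [Pi.smul_apply]; split_ifs <;> simp

theorem removeBox_apply (j : ℕ) (φ : YoungDiagram → R) (lam : YoungDiagram) :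
    removeBox R j φ lam =
      if lam.colLen (j + 1) < lam.colLen j then φ (setCol lam j (lam.colLen j - 1)) else 0 := rfl

/-- The operator that shortens the `j`-th column in all possible ways, by `k` boxes with
weight `f k`. -/
def shortenCol (f : ℕ → R) (j : ℕ) : Module.End R (YoungDiagram → R) where
  toFun φ lam := ∑ k ∈ Finset.range (lam.colLen j - lam.colLen (j + 1) + 1),
    f k * φ (setCol lam j (lam.colLen j - k))
  map_add' φ ψ := by ext lam; simp [mul_add, Finset.sum_add_distrib]
  map_smul' r φ := by ext lam; simp [Finset.mul_sum, mul_left_comm]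

theorem shortenCol_apply (f : ℕ → R) (j : ℕ) (φ : YoungDiagram → R) (lam : YoungDiagram) :
    shortenCol f j φ lam = ∑ k ∈ Finset.range (lam.colLen j - lam.colLen (j + 1) + 1),
      f k * φ (setCol lam j (lam.colLen j - k)) := rfl

/-- Whether column `i` can lose a box depends on columns `i` and `i + 1` only, so distant columns do
not interact. -/
theorem removeBox_far {i j : ℕ} (h : i + 2 ≤ j) : Commute (removeBox R i) (removeBox R j) := by
  change _ = _
  ext φ lam
  simp only [Module.End.mul_apply, removeBox_apply, colLen_setCol]
  have h1 : i ≠ j := by omega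
  have h2 : i + 1 ≠ j := by omega
  have h3 : j + 1 ≠ i := by omega
  have h4 : i + 1 ≠ i := by omega
  simp only [h1, h2, h1.symm, h3, if_false]
  split_ifs
  · congr 1
    apply colLen_injective
    intro k
    simp only [colLen_setCol]
    grind
  all_goals rfl

/-- Operators act on functions, so the left factor acts on the diagram first. Once column `j + 1`
has lost a box, column `j` can always lose one. In both orders the surviving conditions are that
column `j + 1` is longer than column `j + 2` and column `j` longer than column `j + 1`. -/
theorem removeBox_near_left (j : ℕ) :
    Commute (removeBox R (j + 1) * removeBox R j) (removeBox R j) := by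
  change _ = _
  ext φ lam
  have h0 := lam.colLen_anti j (j + 1) (by omega)
  have h0' := lam.colLen_anti (j + 1) (j + 2) (by omega)
  simp only [Module.End.mul_apply, removeBox_apply, colLen_setCol]
  simp
  split_ifs
  all_goals first | omega | rfl | skip
  congr 1
  apply colLen_injective
  intro k
  simp only [colLen_setCol]
  grind

/-- As before, the removal from column `j` is never blocked; in both orders the condition left is
that column `j + 1` exceeds column `j + 2` by at least two boxes. -/
theorem removeBox_near_right (j : ℕ) :
    Commute (removeBox R (j + 1) * removeBox R j) (removeBox R (j + 1)) := by
  change _ = _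
  ext φ lam
  have h0 := lam.colLen_anti j (j + 1) (by omega)
  have h0' := lam.colLen_anti (j + 1) (j + 2) (by omega)
  simp only [Module.End.mul_apply, removeBox_apply, colLen_setCol]
  simp
  split_ifs
  all_goals first | omega | rfl | skip
  congr 1
  apply colLen_injective
  intro k
  simp only [colLen_setCol]
  grind

/-- Shortening by a positive number of boxes begins with the removal of one. Iterated, this makes
`shortenCol f j` the power series with coefficients `f` in `removeBox R j`. -/
theorem shortenCol_eq (f : ℕ → R) (j : ℕ) :
    shortenCol f j = f 0 • 1 + removeBox R j * shortenCol (fun k => f (k + 1)) j := by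
  ext φ lam
  have h0 := lam.colLen_anti j (j + 1) (by omega)
  simp only [Module.End.mul_apply, LinearMap.add_apply, LinearMap.smul_apply, Pi.add_apply,
    Pi.smul_apply, Module.End.one_apply, removeBox_apply, shortenCol_apply, smul_eq_mul]
  rw [Finset.sum_range_succ', add_comm]
  congr 1
  · congr 2
    apply colLen_injective
    intro k
    simp only [colLen_setCol]
    grind
  · split_ifs with h
    · simp only [colLen_setCol]
      have e : min (lam.colLen j) (max (lam.colLen j - 1) (lam.colLen (j + 1))) =
        lam.colLen j - 1 := by omega
      simp only [if_true, e, if_neg (show j + 1 ≠ j by omega)]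
      rw [show lam.colLen j - 1 - lam.colLen (j + 1) + 1 = lam.colLen j - lam.colLen (j + 1) by
        omega]
      refine Finset.sum_congr rfl fun k hk => ?_
      congr 2
      apply colLen_injective
      intro i
      simp only [colLen_setCol]
      grind
    · rw [show lam.colLen j - lam.colLen (j + 1) = 0 by omega]
      simp

theorem commute_removeBox_shortenCol (f : ℕ → R) (j : ℕ) :
    Commute (removeBox R j) (shortenCol f j) := by
  change _ = _
  ext φ lam
  have h0 := lam.colLen_anti j (j + 1) (by omega)
  simp only [Module.End.mul_apply, removeBox_apply, shortenCol_apply]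
  by_cases h : lam.colLen (j + 1) < lam.colLen j
  -- After the maximal shortening no box of column `j` is removable, so the last summand vanishes
  -- and the two ranges agree.
  · rw [if_pos h, Finset.sum_range_succ _ (lam.colLen j - lam.colLen (j + 1))]
    simp only [colLen_setCol]
    have e : min (lam.colLen j) (max (lam.colLen j - 1) (lam.colLen (j + 1))) =
      lam.colLen j - 1 := by omega
    simp only [if_true, e, if_neg (show j + 1 ≠ j by omega)]
    rw [show lam.colLen j - 1 - lam.colLen (j + 1) + 1 = lam.colLen j - lam.colLen (j + 1) by
      omega, if_neg (by omega), mul_zero, add_zero]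
    refine Finset.sum_congr rfl fun k hk => ?_
    rw [Finset.mem_range] at hk
    rw [if_pos (by omega)]
    congr 2
    apply colLen_injective
    intro i
    simp only [colLen_setCol]
    grind
  · rw [if_neg h, show lam.colLen j - lam.colLen (j + 1) = 0 by omega]
    simp only [zero_add, Finset.range_one, Finset.sum_singleton, colLen_setCol]
    rw [if_neg, mul_zero]
    simp
    omega

/-- The inverse of `1 - z D`, where `D` removes a box from the `j`-th column. -/
theorem one_sub_mul_shortenCol (z : R) (j : ℕ) :
    (1 - z • removeBox R j) * shortenCol (fun k => z ^ k) j = 1 := by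
  have h : shortenCol (fun k => z ^ (k + 1)) j = z • shortenCol (fun k => z ^ k) j := by
    ext φ lam
    simp [shortenCol_apply, Finset.mul_sum, pow_succ', mul_assoc]
  rw [sub_mul, one_mul]
  nth_rw 1 [shortenCol_eq]
  rw [h]
  simp

theorem shortenCol_mul_one_sub (z : R) (j : ℕ) :
    shortenCol (fun k => z ^ k) j * (1 - z • removeBox R j) = 1 := by
  have h : Commute (shortenCol (fun k => z ^ k) j) (z • removeBox R j) :=
    (commute_removeBox_shortenCol _ j).symm.smul_right z
  exact ((Commute.one_right _).sub_right h).eq.trans (one_sub_mul_shortenCol z j)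

theorem isUnit_one_sub_removeBox (z : R) (j : ℕ) : IsUnit (1 - z • removeBox R j) :=
  ⟨⟨_, _, one_sub_mul_shortenCol z j, shortenCol_mul_one_sub z j⟩, rfl⟩

/-- Weight for counting the shortened columns. -/
def columnWeight (x : R) (k : ℕ) : R := if k = 0 then 1 else x

/-- Weight for shortening every column by at most one box. -/
def stripWeight (x : R) (k : ℕ) : R := if k = 0 then 1 else if k = 1 then x else 0

/-- With `D` the removal of a box, this is 1 + x (D + D² + ⋯), the geometric series being D times
the inverse of 1 - D. -/
theorem shortenCol_columnWeight (x : R) (j : ℕ) :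
    shortenCol (columnWeight x) j =
      1 + x • (removeBox R j * shortenCol (fun k => (1 : R) ^ k) j) := by
  rw [shortenCol_eq, columnWeight, if_pos rfl, one_smul, ← mul_smul_comm]
  congr 2
  ext φ lam
  simp [shortenCol_apply, columnWeight, Finset.mul_sum]

theorem shortenCol_stripWeight (x : R) (j : ℕ) :
    shortenCol (stripWeight x) j = 1 + x • removeBox R j := by
  rw [shortenCol_eq, stripWeight, if_pos rfl, one_smul, shortenCol_eq]
  have h : shortenCol (fun k => stripWeight x (k + 1 + 1)) j = 0 := by
    ext φ lam
    simp [shortenCol_apply, stripWeight]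
  rw [h]
  simp [stripWeight]

theorem commute_columns (x y : R) (n : ℕ) :
    Commute (descProd (shortenCol (columnWeight x)) n)
      (descProd (shortenCol (columnWeight y)) n) := by
  have hq (j : ℕ) : (1 - removeBox R j) * shortenCol (fun k => (1 : R) ^ k) j = 1 := by
    simpa using one_sub_mul_shortenCol (1 : R) j
  have hq' (j : ℕ) : shortenCol (fun k => (1 : R) ^ k) j * (1 - removeBox R j) = 1 := by
    simpa using shortenCol_mul_one_sub (1 : R) j
  -- Invertibility comes from 1 + z D (1 - D)⁻¹ = (1 - D)⁻¹ (1 - (1 - z) D).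
  have unit (z : R) (j : ℕ) : IsUnit (shortenCol (columnWeight z) j) := by
    have h : shortenCol (columnWeight z) j =
        shortenCol (fun k => (1 : R) ^ k) j * (1 - (1 - z) • removeBox R j) := by
      calc shortenCol (columnWeight z) j
          = shortenCol (fun k => (1 : R) ^ k) j * (1 - removeBox R j) *
              shortenCol (columnWeight z) j := by rw [hq', one_mul]
        _ = shortenCol (fun k => (1 : R) ^ k) j * ((1 - removeBox R j) +
              z • (removeBox R j * ((1 - removeBox R j) *
                shortenCol (fun k => (1 : R) ^ k) j))) := by
            rw [shortenCol_columnWeight, mul_assoc]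
            congr 1
            rw [mul_add, mul_one, mul_smul_comm]
            congr 2
            simp only [sub_mul, mul_sub, one_mul]
        _ = _ := by
            rw [hq, mul_one]
            congr 1
            ext φ lam
            simp only [LinearMap.add_apply, LinearMap.sub_apply, LinearMap.smul_apply,
              Pi.add_apply, Pi.sub_apply, Pi.smul_apply, smul_eq_mul]
            ring
    rw [h]
    exact IsUnit.mul ⟨⟨_, _, hq' j, hq j⟩, rfl⟩ (isUnit_one_sub_removeBox _ j)
  have far (x y : R) (i j : ℕ) (h : i + 2 ≤ j) :
      Commute (shortenCol (columnWeight x) i) (shortenCol (columnWeight y) j) := by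
    rw [shortenCol_columnWeight, shortenCol_columnWeight]
    have c1 := removeBox_far (R := R) h
    have c2 := commute_inverse_one_sub (hq j) (hq' j) c1
    have c3 := c1.mul_right c2
    have c4 := (commute_inverse_one_sub (hq i) (hq' i) c3.symm).symm
    exact (Commute.one_left _).add_left (((Commute.one_right _).add_right
      ((c3.mul_left c4).smul_right y)).smul_left x)
  refine commute_descProd (unit x) (unit y) (fun i => ?_) (far x y) (far y x) (fun i => ?_) n
  · rw [shortenCol_columnWeight, shortenCol_columnWeight]
    exact (Commute.one_left _).add_left (((Commute.one_right _).add_right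
      ((Commute.refl _).smul_right y)).smul_left x)
  · simp only [shortenCol_columnWeight]
    exact commute_geometric (hq _) (hq' _) (hq _) (hq' _) (removeBox_near_left i)
      (removeBox_near_right i) x y

/-- With `a` and `b` the removals from columns `i` and `i + 1`, a neighbouring pair multiplies to 1
+ x (a + b) + x² b a, and `b * a` commutes with `a + b`. -/
theorem commute_strips (x y : R) (n : ℕ) :
    Commute (descProd (shortenCol (stripWeight x)) n)
      (descProd (shortenCol (stripWeight y)) n) := by
  have unit (z : R) (j : ℕ) : IsUnit (shortenCol (stripWeight z) j) := by
    rw [shortenCol_stripWeight]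
    have h : (1 : Module.End R (YoungDiagram → R)) + z • removeBox R j =
        1 - (-z) • removeBox R j := by
      ext φ lam
      simp only [LinearMap.add_apply, LinearMap.sub_apply, LinearMap.smul_apply,
        Pi.add_apply, Pi.sub_apply, Pi.smul_apply, smul_eq_mul]
      ring
    rw [h]
    exact isUnit_one_sub_removeBox (-z) j
  have far (x y : R) (i j : ℕ) (h : i + 2 ≤ j) :
      Commute (shortenCol (stripWeight x) i) (shortenCol (stripWeight y) j) := by
    rw [shortenCol_stripWeight, shortenCol_stripWeight]
    exact (Commute.one_left _).add_left (((Commute.one_right _).add_right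
      ((removeBox_far h).smul_right y)).smul_left x)
  refine commute_descProd (unit x) (unit y) (fun i => ?_) (far x y) (far y x) (fun i => ?_) n
  · rw [shortenCol_stripWeight, shortenCol_stripWeight]
    exact (Commute.one_left _).add_left (((Commute.one_right _).add_right
      ((Commute.refl _).smul_right y)).smul_left x)
  · simp only [shortenCol_stripWeight]
    set a := removeBox R i
    set b := removeBox R (i + 1)
    have h (x : R) : (1 + x • b) * (1 + x • a) = 1 + x • (a + b) + (x * x) • (b * a) := by
      simp only [mul_add, add_mul, one_mul, mul_one, smul_mul_assoc, mul_smul_comm, smul_add,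
        mul_smul]
      abel
    have c : Commute (b * a) (a + b) :=
      (removeBox_near_left i).add_right (removeBox_near_right i)
    rw [h, h]
    refine Commute.add_left (Commute.add_left ?_ ?_) ?_
    · exact Commute.one_left _
    · exact ((Commute.one_right _).add_right ((Commute.refl _).smul_left _ |>.smul_right _)
        |>.add_right (c.symm.smul_left _ |>.smul_right _))
    · exact ((Commute.one_right _).add_right (c.smul_left _ |>.smul_right _)
        |>.add_right ((Commute.refl _).smul_left _ |>.smul_right _))

end Columns

/-! ### Commuting steps between Young diagrams -/

section Steps

theorem mem_between {mu nu lam : YoungDiagram} : nu ∈ between mu lam ↔ mu ≤ nu ∧ nu ≤ lam := by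
  simp [between]

theorem colLen_eq_zero {lam : YoungDiagram} {j : ℕ} (h : lam.rowLen 0 ≤ j) :
    lam.colLen j = 0 := by
  by_contra h0
  have h1 := YoungDiagram.mem_iff_lt_colLen.mpr (Nat.pos_of_ne_zero h0)
  have h2 := YoungDiagram.mem_iff_lt_rowLen.mp h1
  omega

open Classical in
-- The columns are shortened from right to left, so the bound on each column is the length of its
-- right neighbour after shortening. Hence every smaller diagram that differs only in the first `n`
-- columns is reached exactly once.
theorem descProd_shortenCol {R : Type*} [CommRing R] (f : ℕ → R) (n : ℕ)
    (φ : YoungDiagram → R) (lam : YoungDiagram) :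
    descProd (shortenCol f) n φ lam =
      ∑ mu ∈ (between ⊥ lam).filter (fun mu => ∀ j, n ≤ j → mu.colLen j = lam.colLen j),
        (∏ j ∈ Finset.range n, f (lam.colLen j - mu.colLen j)) * φ mu := by
  induction n generalizing lam with
  | zero =>
    have h : (between ⊥ lam).filter (fun mu => ∀ j, 0 ≤ j → mu.colLen j = lam.colLen j) =
        {lam} := by
      ext mu
      simp only [Finset.mem_filter, mem_between, Finset.mem_singleton]
      constructor
      · exact fun h => colLen_injective fun j => h.2 j (Nat.zero_le j)
      · rintro rfl
        simp
    rw [h]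
    simp [descProd]
  | succ n ih =>
    rw [descProd, Module.End.mul_apply, shortenCol_apply]
    have h0 := lam.colLen_anti n (n + 1) (by omega)
    have hmaps : ∀ mu ∈ (between ⊥ lam).filter
        (fun mu => ∀ j, n + 1 ≤ j → mu.colLen j = lam.colLen j),
        lam.colLen n - mu.colLen n ∈
          Finset.range (lam.colLen n - lam.colLen (n + 1) + 1) := by
      intro mu hmu
      simp only [Finset.mem_filter, mem_between] at hmu
      have h1 := hmu.2 (n + 1) le_rfl
      have h2 := mu.colLen_anti n (n + 1) (by omega)
      rw [Finset.mem_range]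
      omega
    -- The smaller diagrams are grouped by the number of boxes lost in column `n`, the first column
    -- to be shortened.
    rw [← Finset.sum_fiberwise_of_maps_to hmaps]
    refine Finset.sum_congr rfl fun k hk => ?_
    rw [Finset.mem_range] at hk
    rw [ih, Finset.mul_sum]
    have hset : (between ⊥ (setCol lam n (lam.colLen n - k))).filter
          (fun mu => ∀ j, n ≤ j → mu.colLen j =
            (setCol lam n (lam.colLen n - k)).colLen j) =
        ((between ⊥ lam).filter
          (fun mu => ∀ j, n + 1 ≤ j → mu.colLen j = lam.colLen j)).filter
          (fun mu => lam.colLen n - mu.colLen n = k) := by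
      ext mu
      simp only [Finset.mem_filter, mem_between, bot_le, true_and, le_iff_colLen_le,
        colLen_setCol]
      constructor
      · rintro ⟨h1, h2⟩
        have h3 := h2 n le_rfl
        rw [if_pos rfl] at h3
        refine ⟨⟨fun j => ?_, fun j hj => ?_⟩, by omega⟩
        · have := h1 j
          split_ifs at this with hj
          · subst hj; omega
          · exact this
        · have := h2 j (by omega)
          rwa [if_neg (by omega)] at this
      · rintro ⟨⟨h1, h2⟩, h3⟩
        have h4 := h1 n
        refine ⟨fun j => ?_, fun j hj => ?_⟩
        · split_ifs with hj
          · subst hj; omega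
          · exact h1 j
        · split_ifs with hj'
          · subst hj'; omega
          · exact h2 j (by omega)
    rw [hset]
    refine Finset.sum_congr rfl fun mu hmu => ?_
    rw [Finset.mem_filter] at hmu
    rw [Finset.prod_range_succ, hmu.2]
    have : ∀ j ∈ Finset.range n, f ((setCol lam n (lam.colLen n - k)).colLen j - mu.colLen j) =
        f (lam.colLen j - mu.colLen j) := by
      intro j hj
      rw [Finset.mem_range] at hj
      rw [colLen_setCol, if_neg (by omega)]
    rw [Finset.prod_congr rfl this]
    ring

theorem descProd_shortenCol_of_le {R : Type*} [CommRing R] (f : ℕ → R) {n : ℕ}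
    (φ : YoungDiagram → R) {lam : YoungDiagram} (hn : lam.rowLen 0 ≤ n) :
    descProd (shortenCol f) n φ lam =
      ∑ mu ∈ between ⊥ lam, (∏ j ∈ Finset.range n, f (lam.colLen j - mu.colLen j)) * φ mu := by
  classical
  rw [descProd_shortenCol, Finset.filter_true_of_mem]
  intro mu hmu j hj
  have h1 : lam.colLen j = 0 := colLen_eq_zero (hn.trans hj)
  have h2 := le_iff_colLen_le.mp (mem_between.mp hmu).2 j
  omega

theorem rowLen_zero_mono {mu lam : YoungDiagram} (h : mu ≤ lam) : mu.rowLen 0 ≤ lam.rowLen 0 := by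
  by_contra! hlt
  exact lt_irrefl _ (YoungDiagram.mem_iff_lt_rowLen.mp (h (YoungDiagram.mem_iff_lt_rowLen.mpr hlt)))

/-- This is the commutation of the operators, applied to the indicator function of `mu` and
evaluated at `lam`; with `n` at least the number of columns, all subdiagrams are reached. -/
theorem sum_between_comm {R : Type*} [CommRing R] (f g : ℕ → R) (mu lam : YoungDiagram) (n : ℕ)
    (hn : lam.rowLen 0 ≤ n)
    (h : Commute (descProd (shortenCol f) n) (descProd (shortenCol g) n)) :
    ∑ nu ∈ between mu lam, (∏ j ∈ Finset.range n, f (lam.colLen j - nu.colLen j)) *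
        (∏ j ∈ Finset.range n, g (nu.colLen j - mu.colLen j)) =
      ∑ nu ∈ between mu lam, (∏ j ∈ Finset.range n, g (lam.colLen j - nu.colLen j)) *
        (∏ j ∈ Finset.range n, f (nu.colLen j - mu.colLen j)) := by
  classical
  have key : ∀ f g : ℕ → R,
      (descProd (shortenCol f) n * descProd (shortenCol g) n) (Pi.single mu 1) lam =
      ∑ nu ∈ between mu lam, (∏ j ∈ Finset.range n, f (lam.colLen j - nu.colLen j)) *
        (∏ j ∈ Finset.range n, g (nu.colLen j - mu.colLen j)) := by
    intro f g
    rw [Module.End.mul_apply, descProd_shortenCol_of_le _ _ hn]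
    have hsub : between mu lam ⊆ between ⊥ lam := fun nu h =>
      mem_between.mpr ⟨bot_le, (mem_between.mp h).2⟩
    rw [← Finset.sum_subset hsub]
    · refine Finset.sum_congr rfl fun nu hnu => ?_
      rw [mem_between] at hnu
      rw [descProd_shortenCol_of_le _ _ ((rowLen_zero_mono hnu.2).trans hn)]
      congr 1
      rw [Finset.sum_eq_single mu]
      · simp
      · intro b _ hb
        rw [Pi.single_eq_of_ne hb, mul_zero]
      · intro h
        exact absurd (mem_between.mpr ⟨bot_le, hnu.1⟩) h
    · intro nu h1 h2
      rw [mem_between] at h1 h2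
      rw [descProd_shortenCol_of_le _ _ ((rowLen_zero_mono h1.2).trans hn), Finset.sum_eq_zero,
        mul_zero]
      intro b hb
      rw [mem_between] at hb
      rw [Pi.single_eq_of_ne, mul_zero]
      rintro rfl
      exact h2 ⟨hb.2, h1.2⟩
  rw [← key, ← key, h.eq]

/-- Comparison of coefficients in a polynomial identity in two variables. -/
theorem card_filter_eq_of_sum_pow_eq {ι : Type*} [DecidableEq ι] (s s' : Finset ι)
    (a b a' b' : ι → ℕ)
    (h : ∑ i ∈ s, (Polynomial.C Polynomial.X : Polynomial (Polynomial ℤ)) ^ a i *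
          Polynomial.X ^ b i =
        ∑ i ∈ s', (Polynomial.C Polynomial.X : Polynomial (Polynomial ℤ)) ^ a' i *
          Polynomial.X ^ b' i) (k l : ℕ) :
    (s.filter fun i => a i = k ∧ b i = l).card = (s'.filter fun i => a' i = k ∧ b' i = l).card := by
  have key : ∀ (s : Finset ι) (a b : ι → ℕ),
      ((∑ i ∈ s, (Polynomial.C Polynomial.X : Polynomial (Polynomial ℤ)) ^ a i *
          Polynomial.X ^ b i).coeff l).coeff k =
        ((s.filter fun i => a i = k ∧ b i = l).card : ℤ) := by
    intro s a b
    rw [Polynomial.finsetSum_coeff, Polynomial.finsetSum_coeff, Finset.card_filter, Nat.cast_sum]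
    refine Finset.sum_congr rfl fun i _ => ?_
    rw [← Polynomial.C_pow, Polynomial.coeff_C_mul_X_pow]
    by_cases h1 : b i = l
    · by_cases h2 : a i = k
      · simp [h1, h2]
      · simp [h1, h2, Polynomial.coeff_X_pow, Ne.symm h2]
    · simp [h1, Ne.symm h1]
  have := congrArg (fun p : Polynomial (Polynomial ℤ) => (p.coeff l).coeff k) h
  simp only [key] at this
  exact_mod_cast this

theorem numCols_eq {lam mu : YoungDiagram} {n : ℕ} (hn : lam.rowLen 0 ≤ n) :
    numCols lam mu = ((Finset.range n).filter fun j => mu.colLen j < lam.colLen j).card := by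
  rw [numCols]
  congr 1
  ext j
  simp only [Finset.mem_image, skewCells, Finset.mem_sdiff, YoungDiagram.mem_cells, Prod.exists,
    Finset.mem_filter, Finset.mem_range, exists_eq_right, YoungDiagram.mem_iff_lt_colLen, not_lt]
  constructor
  · rintro ⟨i, h1, h2⟩
    refine ⟨?_, by omega⟩
    by_contra! h
    rw [colLen_eq_zero (hn.trans h)] at h1
    omega
  · rintro ⟨-, h⟩
    exact ⟨mu.colLen j, h, le_rfl⟩

theorem prod_columnWeight {R : Type*} [CommRing R] (x : R) {lam mu : YoungDiagram} {n : ℕ}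
    (hn : lam.rowLen 0 ≤ n) :
    ∏ j ∈ Finset.range n, columnWeight x (lam.colLen j - mu.colLen j) = x ^ numCols lam mu := by
  rw [numCols_eq hn, ← Finset.prod_const, Finset.prod_filter]
  refine Finset.prod_congr rfl fun j _ => ?_
  rw [columnWeight]
  split_ifs <;> first | rfl | omega

theorem card_eq_sum_colLen {lam : YoungDiagram} {n : ℕ} (hn : lam.rowLen 0 ≤ n) :
    lam.card = ∑ j ∈ Finset.range n, lam.colLen j := by
  have hmaps : ∀ c ∈ lam.cells, c.2 ∈ Finset.range n := by
    intro c hc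
    rw [Finset.mem_range]
    by_contra! h
    have := YoungDiagram.mem_iff_lt_colLen.mp ((YoungDiagram.mem_cells _).mp hc)
    rw [colLen_eq_zero (hn.trans h)] at this
    omega
  rw [YoungDiagram.card, Finset.card_eq_sum_card_fiberwise hmaps]
  refine Finset.sum_congr rfl fun j _ => ?_
  rw [YoungDiagram.colLen_eq_card]
  rfl

/-- `lam / mu` has at most one box in each column. -/
def IsStrip (lam mu : YoungDiagram) : Prop := ∀ j, lam.colLen j ≤ mu.colLen j + 1

open Classical in
theorem prod_stripWeight {R : Type*} [CommRing R] (x : R) {lam mu : YoungDiagram} {n : ℕ}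
    (hn : lam.rowLen 0 ≤ n) (hle : mu ≤ lam) :
    ∏ j ∈ Finset.range n, stripWeight x (lam.colLen j - mu.colLen j) =
      if IsStrip lam mu then x ^ (lam.card - mu.card) else 0 := by
  split_ifs with h
  · rw [card_eq_sum_colLen hn, card_eq_sum_colLen ((rowLen_zero_mono hle).trans hn),
      ← Finset.sum_tsub_distrib _ fun j _ => le_iff_colLen_le.mp hle j, ← Finset.prod_pow_eq_pow_sum]
    refine Finset.prod_congr rfl fun j _ => ?_
    have := h j
    obtain h1 | h1 : lam.colLen j - mu.colLen j = 0 ∨ lam.colLen j - mu.colLen j = 1 := by omega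
    · simp [h1, stripWeight]
    · simp [h1, stripWeight]
  · rw [IsStrip] at h
    push Not at h
    obtain ⟨j, hj⟩ := h
    have hjn : j ∈ Finset.range n := by
      rw [Finset.mem_range]
      by_contra! h
      rw [colLen_eq_zero (hn.trans h)] at hj
      omega
    refine Finset.prod_eq_zero hjn ?_
    rw [stripWeight, if_neg (by omega), if_neg (by omega)]

/-- `lam / mu` has exactly `k` nonempty columns. -/
def ColStep (k : ℕ) (mu lam : YoungDiagram) : Prop := mu ≤ lam ∧ numCols lam mu = k

/-- `lam / mu` is a horizontal strip of size `k`. -/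
def StripStep (k : ℕ) (mu lam : YoungDiagram) : Prop :=
  mu ≤ lam ∧ IsStrip lam mu ∧ lam.card = mu.card + k

open Classical in
-- The weights are taken to be independent indeterminates over ℤ, so the equality of generating
-- functions separates into equalities of the individual counts.
theorem card_colStep_comm (mu lam : YoungDiagram) (k l : ℕ) :
    ((between mu lam).filter fun nu => ColStep k mu nu ∧ ColStep l nu lam).card =
      ((between mu lam).filter fun nu => ColStep l mu nu ∧ ColStep k nu lam).card := by
  have key := sum_between_comm
    (columnWeight (Polynomial.C Polynomial.X : Polynomial (Polynomial ℤ)))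
    (columnWeight (Polynomial.X : Polynomial (Polynomial ℤ))) mu lam _ le_rfl
    (commute_columns _ _ _)
  have h : ∀ x y : Polynomial (Polynomial ℤ), ∑ nu ∈ between mu lam,
      (∏ j ∈ Finset.range (lam.rowLen 0), columnWeight x (lam.colLen j - nu.colLen j)) *
        (∏ j ∈ Finset.range (lam.rowLen 0), columnWeight y (nu.colLen j - mu.colLen j)) =
      ∑ nu ∈ between mu lam, x ^ numCols lam nu * y ^ numCols nu mu := by
    refine fun x y => Finset.sum_congr rfl fun nu hnu => ?_
    rw [prod_columnWeight _ le_rfl,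
      prod_columnWeight _ (rowLen_zero_mono (mem_between.mp hnu).2)]
  rw [h, h] at key
  simp_rw [mul_comm (Polynomial.X ^ _)] at key
  have := card_filter_eq_of_sum_pow_eq _ _ _ _ _ _ key l k
  have e1 := Finset.filter_congr (s := between mu lam)
    (p := fun nu => ColStep k mu nu ∧ ColStep l nu lam)
    (q := fun nu => numCols lam nu = l ∧ numCols nu mu = k) fun nu hnu => by
      rw [mem_between] at hnu
      simp only [ColStep, hnu.1, hnu.2, true_and, and_comm]
  have e2 := Finset.filter_congr (s := between mu lam)
    (p := fun nu => ColStep l mu nu ∧ ColStep k nu lam)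
    (q := fun nu => numCols nu mu = l ∧ numCols lam nu = k) fun nu hnu => by
      rw [mem_between] at hnu
      simp only [ColStep, hnu.1, hnu.2, true_and]
  rw [e1, e2]
  convert this

theorem card_mono {mu lam : YoungDiagram} (h : mu ≤ lam) : mu.card ≤ lam.card :=
  Finset.card_le_card (YoungDiagram.cells_subset_iff.mpr h)

open Classical in
theorem card_stripStep_comm (mu lam : YoungDiagram) (k l : ℕ) :
    ((between mu lam).filter fun nu => StripStep k mu nu ∧ StripStep l nu lam).card =
      ((between mu lam).filter fun nu => StripStep l mu nu ∧ StripStep k nu lam).card := by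
  have key := sum_between_comm
    (stripWeight (Polynomial.C Polynomial.X : Polynomial (Polynomial ℤ)))
    (stripWeight (Polynomial.X : Polynomial (Polynomial ℤ))) mu lam _ le_rfl
    (commute_strips _ _ _)
  have h : ∀ x y : Polynomial (Polynomial ℤ), ∑ nu ∈ between mu lam,
      (∏ j ∈ Finset.range (lam.rowLen 0), stripWeight x (lam.colLen j - nu.colLen j)) *
        (∏ j ∈ Finset.range (lam.rowLen 0), stripWeight y (nu.colLen j - mu.colLen j)) =
      ∑ nu ∈ (between mu lam).filter (fun nu => IsStrip lam nu ∧ IsStrip nu mu),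
        x ^ (lam.card - nu.card) * y ^ (nu.card - mu.card) := by
    intro x y
    rw [Finset.sum_filter]
    refine Finset.sum_congr rfl fun nu hnu => ?_
    rw [mem_between] at hnu
    rw [prod_stripWeight _ le_rfl hnu.2,
      prod_stripWeight _ (rowLen_zero_mono hnu.2) hnu.1]
    by_cases h1 : IsStrip lam nu <;> by_cases h2 : IsStrip nu mu <;> simp [h1, h2]
  rw [h, h] at key
  simp_rw [mul_comm (Polynomial.X ^ _)] at key
  have := card_filter_eq_of_sum_pow_eq _ _ _ _ _ _ key l k
  rw [Finset.filter_filter, Finset.filter_filter] at this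
  have e1 := Finset.filter_congr (s := between mu lam)
    (p := fun nu => StripStep k mu nu ∧ StripStep l nu lam)
    (q := fun nu => (IsStrip lam nu ∧ IsStrip nu mu) ∧
      lam.card - nu.card = l ∧ nu.card - mu.card = k) fun nu hnu => by
      rw [mem_between] at hnu
      have h1 := card_mono hnu.1
      have h2 := card_mono hnu.2
      simp only [StripStep, hnu.1, hnu.2, true_and]
      constructor
      · rintro ⟨⟨a, b⟩, c, d⟩
        exact ⟨⟨c, a⟩, by omega, by omega⟩
      · rintro ⟨⟨a, b⟩, c, d⟩
        exact ⟨⟨b, by omega⟩, a, by omega⟩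
  have e2 := Finset.filter_congr (s := between mu lam)
    (p := fun nu => StripStep l mu nu ∧ StripStep k nu lam)
    (q := fun nu => (IsStrip lam nu ∧ IsStrip nu mu) ∧
      nu.card - mu.card = l ∧ lam.card - nu.card = k) fun nu hnu => by
      rw [mem_between] at hnu
      have h1 := card_mono hnu.1
      have h2 := card_mono hnu.2
      simp only [StripStep, hnu.1, hnu.2, true_and]
      constructor
      · rintro ⟨⟨a, b⟩, c, d⟩
        exact ⟨⟨c, a⟩, by omega, by omega⟩
      · rintro ⟨⟨a, b⟩, c, d⟩
        exact ⟨⟨b, by omega⟩, a, by omega⟩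
  rw [e1, e2]
  convert this

end Steps

/-! ### Counting paths of commuting steps -/

section Paths

open Classical in
noncomputable instance : LocallyFiniteOrder YoungDiagram :=
  LocallyFiniteOrder.ofIcc YoungDiagram between fun _ _ _ => mem_between

theorem Icc_eq_between (mu lam : YoungDiagram) : Finset.Icc mu lam = between mu lam := by
  ext nu
  rw [Finset.mem_Icc, mem_between]

open Classical in
/-- A family of commuting steps, as needed for symmetric generating functions. -/
structure IsSteps (Q : ℕ → YoungDiagram → YoungDiagram → Prop) : Prop where
  le : ∀ {k : ℕ} {mu lam : YoungDiagram}, Q k mu lam → mu ≤ lam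
  zero_iff : ∀ {mu lam}, Q 0 mu lam ↔ mu = lam
  comm : ∀ mu lam k l,
    ((between mu lam).filter fun nu => Q k mu nu ∧ Q l nu lam).card =
      ((between mu lam).filter fun nu => Q l mu nu ∧ Q k nu lam).card

open Classical in
/-- The steps `Q k` as an element of the incidence algebra of Young's lattice. -/
noncomputable def stepElem (K : Type*) [CommRing K] (Q : ℕ → YoungDiagram → YoungDiagram → Prop)
    (k : ℕ) : IncidenceAlgebra K YoungDiagram where
  toFun mu lam := if mu ≤ lam ∧ Q k mu lam then 1 else 0
  eq_zero_of_not_le' _ _ h := if_neg fun h' => h h'.1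

variable {K : Type*} [CommRing K] {Q : ℕ → YoungDiagram → YoungDiagram → Prop}

open Classical in
theorem stepElem_apply (hQ : IsSteps Q) (k : ℕ) (mu lam : YoungDiagram) :
    stepElem K Q k mu lam = if Q k mu lam then 1 else 0 := by
  change (if mu ≤ lam ∧ Q k mu lam then (1 : K) else 0) = _
  by_cases h : Q k mu lam
  · rw [if_pos ⟨hQ.le h, h⟩, if_pos h]
  · rw [if_neg fun h' => h h'.2, if_neg h]

open Classical in
theorem stepElem_zero (hQ : IsSteps Q) : stepElem K Q 0 = 1 := by
  ext mu lam _
  rw [stepElem_apply hQ, IncidenceAlgebra.one_apply]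
  simp only [hQ.zero_iff]

theorem stepElem_comm (hQ : IsSteps Q) (k l : ℕ) :
    stepElem K Q k * stepElem K Q l = stepElem K Q l * stepElem K Q k := by
  classical
  have key : ∀ k l mu lam, (stepElem K Q k * stepElem K Q l) mu lam =
      (((between mu lam).filter fun nu => Q k mu nu ∧ Q l nu lam).card : K) := by
    intro k l mu lam
    rw [IncidenceAlgebra.mul_apply, Icc_eq_between, Finset.card_filter, Nat.cast_sum]
    refine Finset.sum_congr rfl fun nu _ => ?_
    rw [stepElem_apply hQ, stepElem_apply hQ]
    by_cases h1 : Q k mu nu <;> by_cases h2 : Q l nu lam <;> simp [h1, h2]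
  ext mu lam _
  rw [key, key, hQ.comm]

open Classical in
/-- The submonoid generated by the steps is commutative. -/
noncomputable abbrev stepMonoid (K : Type*) [CommRing K] (hQ : IsSteps Q) :
    CommMonoid (Submonoid.closure (Set.range (stepElem K Q))) where
  mul_comm :=
    (Submonoid.isMulCommutative_closure _ (by
      rintro _ ⟨k, rfl⟩ _ ⟨l, rfl⟩
      exact stepElem_comm hQ k l)).is_comm.comm

open Classical in
/-- The number of paths whose steps have the sizes prescribed by `n`. -/
noncomputable def pathElem (K : Type*) [CommRing K] (hQ : IsSteps Q) (n : ℕ →₀ ℕ) :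
    IncidenceAlgebra K YoungDiagram :=
  letI := stepMonoid K hQ
  ((n.prod fun _ k => (⟨stepElem K Q k, Submonoid.subset_closure ⟨k, rfl⟩⟩ :
    Submonoid.closure (Set.range (stepElem K Q)))) :
      Submonoid.closure (Set.range (stepElem K Q)))

open Classical in
theorem pathElem_zero (hQ : IsSteps Q) : pathElem K hQ 0 = 1 := by
  simp only [pathElem, Finsupp.prod_zero_index]
  rfl

open Classical in
theorem pathElem_add_single (hQ : IsSteps Q) (n : ℕ →₀ ℕ) {M : ℕ} (hM : n M = 0) (k : ℕ) :
    pathElem K hQ (n + Finsupp.single M k) = pathElem K hQ n * stepElem K Q k := by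
  let := stepMonoid K hQ
  have h0 : (⟨stepElem K Q 0, Submonoid.subset_closure ⟨0, rfl⟩⟩ :
      Submonoid.closure (Set.range (stepElem K Q))) = 1 := Subtype.ext (stepElem_zero hQ)
  have hd : Disjoint n.support (Finsupp.single M k).support := by
    refine Finset.disjoint_of_subset_right Finsupp.support_single_subset ?_
    rw [Finset.disjoint_singleton_right]
    simpa using hM
  simp only [pathElem]
  rw [Finsupp.prod_add_index_of_disjoint hd, Finsupp.prod_single_index h0]
  rfl

open Classical in
-- Since the steps commute, the step of index `M` may also be taken first; the second expansion of
-- the main theorem rests on this.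
theorem pathElem_single_add (hQ : IsSteps Q) (n : ℕ →₀ ℕ) {M : ℕ} (hM : n M = 0) (k : ℕ) :
    pathElem K hQ (n + Finsupp.single M k) = stepElem K Q k * pathElem K hQ n := by
  let := stepMonoid K hQ
  rw [pathElem_add_single hQ n hM]
  simp only [pathElem]
  exact congrArg Subtype.val (mul_comm (n.prod fun _ k =>
    (⟨stepElem K Q k, Submonoid.subset_closure ⟨k, rfl⟩⟩ :
      Submonoid.closure (Set.range (stepElem K Q)))) ⟨_, Submonoid.subset_closure ⟨k, rfl⟩⟩)

open Classical in
-- A product in a commutative monoid does not see how its factors are labelled. This is the source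
-- of all symmetry in the variables.
theorem pathElem_mapDomain (hQ : IsSteps Q) {σ : ℕ → ℕ} (hσ : Function.Injective σ)
    (n : ℕ →₀ ℕ) : pathElem K hQ (n.mapDomain σ) = pathElem K hQ n := by
  let := stepMonoid K hQ
  simp only [pathElem]
  rw [Finsupp.prod_mapDomain_index_inj hσ]

open Classical in
/-- Functions that satisfy the recursion of paths count paths. -/
theorem eq_pathElem (hQ : IsSteps Q) {mu : YoungDiagram} {g : YoungDiagram → (ℕ →₀ ℕ) → K}
    (h0 : ∀ lam, mu ≤ lam → g lam 0 = if mu = lam then 1 else 0)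
    (hs : ∀ lam, mu ≤ lam → ∀ (n : ℕ →₀ ℕ) (M k : ℕ), (∀ i ∈ n.support, i < M) →
      g lam (n + Finsupp.single M k) =
        ∑ nu ∈ (between mu lam).filter (fun nu => Q k nu lam), g nu n)
    (lam : YoungDiagram) (hle : mu ≤ lam) (n : ℕ →₀ ℕ) :
    g lam n = pathElem K hQ n mu lam := by
  induction n using Finsupp.induction_on_max generalizing lam with
  | zero => rw [h0 lam hle, pathElem_zero, IncidenceAlgebra.one_apply]
  | single_add M k n hM hk ih =>
    have hn : n M = 0 := by
      by_contra h
      exact lt_irrefl _ (hM M (Finsupp.mem_support_iff.mpr h))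
    rw [add_comm, hs lam hle n M k hM, pathElem_add_single hQ n hn, IncidenceAlgebra.mul_apply,
      Icc_eq_between, Finset.sum_filter]
    refine Finset.sum_congr rfl fun nu hnu => ?_
    rw [stepElem_apply hQ, ih nu (mem_between.mp hnu).1, mul_ite, mul_one, mul_zero]

theorem isSteps_colStep : IsSteps ColStep where
  le h := h.1
  zero_iff := by
    intro mu lam
    constructor
    · rintro ⟨h1, h2⟩
      rw [numCols, Finset.card_eq_zero, Finset.image_eq_empty, skewCells,
        Finset.sdiff_eq_empty_iff_subset, YoungDiagram.cells_subset_iff] at h2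
      exact le_antisymm h1 h2
    · rintro rfl
      simp [ColStep, numCols, skewCells]
  comm := card_colStep_comm

theorem isSteps_stripStep : IsSteps StripStep where
  le h := h.1
  zero_iff := by
    intro mu lam
    constructor
    · rintro ⟨h1, -, h3⟩
      ext1
      exact Finset.eq_of_subset_of_card_le (YoungDiagram.cells_subset_iff.mpr h1) h3.le
    · rintro rfl
      exact ⟨le_rfl, fun j => by omega, rfl⟩
  comm := card_stripStep_comm

end Paths

/-! ### Removing the largest entries of a tableau -/

section Tableaux

theorem mem_skewCells {lam mu : YoungDiagram} {c : ℕ × ℕ} :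
    c ∈ skewCells lam mu ↔ c ∈ lam ∧ c ∉ mu := by
  simp [skewCells]

theorem RPP.ext' {lam mu : YoungDiagram} {T T' : RPP lam mu} (h : ∀ c, T.entry c = T'.entry c) :
    T = T' := by
  cases T
  cases T'
  congr
  exact funext h

theorem RPP.mem_entryCols {lam mu : YoungDiagram} {T : RPP lam mu} {p : ℕ × ℕ} :
    p ∈ T.entryCols ↔ ∃ c, T.entry c = p.1 ∧ c.1.2 = p.2 := by
  simp only [RPP.entryCols, Finset.mem_image, Finset.mem_univ, true_and, Prod.ext_iff]

theorem RPP.weight_ne_zero {lam mu : YoungDiagram} (T : RPP lam mu) (i : ℕ) :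
    T.weight i ≠ 0 ↔ ∃ c, T.entry c = i := by
  rw [RPP.weight_apply, Finset.card_ne_zero]
  constructor
  · rintro ⟨p, hp⟩
    rw [Finset.mem_filter, RPP.mem_entryCols] at hp
    obtain ⟨⟨c, hc, -⟩, hi⟩ := hp
    exact ⟨c, hc.trans hi⟩
  · rintro ⟨c, rfl⟩
    exact ⟨(T.entry c, c.1.2), Finset.mem_filter.mpr ⟨RPP.mem_entryCols.mpr ⟨c, rfl, rfl⟩, rfl⟩⟩

/-- All entries lie in the support of `n`, so `Nat.card` is a genuine count and not the default
value 0 for infinite types. -/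
instance RPP.finite_weight (lam mu : YoungDiagram) (n : ℕ →₀ ℕ) :
    Finite {T : RPP lam mu // T.weight = n} := by
  refine Finite.of_injective (β := {c // c ∈ skewCells lam mu} → n.support)
    (fun T c => ⟨T.1.entry c, ?_⟩) ?_
  · have := (T.1.weight_ne_zero _).mpr ⟨c, rfl⟩
    rwa [T.2, ← Finsupp.mem_support_iff] at this
  · intro T T' h
    refine Subtype.ext (RPP.ext' fun c => ?_)
    exact congrArg Subtype.val (congrFun h c)

/-- Fill the boxes of `lam / nu` with `M`. -/
def RPP.extend {lam mu nu : YoungDiagram} (T : RPP nu mu) (M : ℕ)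
    (hM : ∀ c, T.entry c < M) : RPP lam mu where
  entry c := if h : c.1 ∈ skewCells nu mu then T.entry ⟨c.1, h⟩ else M
  row_weak c d h1 h2 := by
    by_cases hd : d.1 ∈ skewCells nu mu
    · have hc : c.1 ∈ skewCells nu mu := mem_skewCells.mpr
        ⟨nu.up_left_mem h1.le h2 (mem_skewCells.mp hd).1, (mem_skewCells.mp c.2).2⟩
      rw [dif_pos hd, dif_pos hc]
      exact T.row_weak _ _ h1 h2
    · rw [dif_neg hd]
      split_ifs
      · exact (hM _).le
      · exact le_rfl
  col_weak c d h1 h2 := by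
    by_cases hd : d.1 ∈ skewCells nu mu
    · have hc : c.1 ∈ skewCells nu mu := mem_skewCells.mpr
        ⟨nu.up_left_mem h2 h1.le (mem_skewCells.mp hd).1, (mem_skewCells.mp c.2).2⟩
      rw [dif_pos hd, dif_pos hc]
      exact T.col_weak _ _ h1 h2
    · rw [dif_neg hd]
      split_ifs
      · exact (hM _).le
      · exact le_rfl

/-- The entry `M` is new, so its pairs (entry, column) are disjoint from those of `T`, and there is
one for each nonempty column of `lam / nu`. -/
theorem RPP.weight_extend {lam mu nu : YoungDiagram} (h1 : mu ≤ nu) (h2 : nu ≤ lam)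
    (T : RPP nu mu) (M : ℕ) (hM : ∀ c, T.entry c < M) :
    (T.extend M hM : RPP lam mu).weight = T.weight + Finsupp.single M (numCols lam nu) := by
  have key : (T.extend M hM : RPP lam mu).entryCols =
      T.entryCols ∪ ((skewCells lam nu).image Prod.snd).image (fun j => (M, j)) := by
    ext ⟨i, j⟩
    simp only [Finset.mem_union, RPP.mem_entryCols, Finset.mem_image, Prod.mk.injEq, RPP.extend]
    constructor
    · rintro ⟨c, hc, hj⟩
      split_ifs at hc with h
      · exact Or.inl ⟨⟨c.1, h⟩, hc, hj⟩
      · have := mem_skewCells.mp c.2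
        refine Or.inr ⟨j, ⟨c.1, mem_skewCells.mpr ⟨this.1, fun h' => h ?_⟩, hj⟩, hc, rfl⟩
        exact mem_skewCells.mpr ⟨h', this.2⟩
    · rintro (⟨c, hc, hj⟩ | ⟨j', ⟨c, hc, hj⟩, hi, rfl⟩)
      · have := mem_skewCells.mp c.2
        refine ⟨⟨c.1, mem_skewCells.mpr ⟨h2 this.1, this.2⟩⟩, ?_, hj⟩
        rw [dif_pos c.2]
        exact hc
      · have := mem_skewCells.mp hc
        refine ⟨⟨c, mem_skewCells.mpr ⟨this.1, fun h => this.2 (h1 h)⟩⟩, ?_, hj⟩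
        rw [dif_neg fun h => this.2 (mem_skewCells.mp h).1]
        exact hi
  rw [RPP.weight, key, Finset.sum_union]
  · congr 1
    rw [Finset.sum_image (fun a _ b _ h => (Prod.mk.inj h).2)]
    change ∑ _ ∈ (skewCells lam nu).image Prod.snd, Finsupp.single M 1 = _
    rw [Finset.sum_const,
      Finsupp.smul_single, numCols, smul_eq_mul, mul_one]
  · rw [Finset.disjoint_left]
    rintro ⟨i, j⟩ hp hq
    obtain ⟨c, hc, -⟩ := RPP.mem_entryCols.mp hp
    simp only [Finset.mem_image, Prod.mk.injEq] at hq
    obtain ⟨_, _, hi, _⟩ := hq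
    have := hM c
    simp only at hc
    omega

/-- The part of a reverse plane partition with entries less than `M`, as a diagram. -/
def RPP.lower {lam mu : YoungDiagram} (T : RPP lam mu) (M : ℕ) :
    YoungDiagram where
  cells := lam.cells.filter fun c => ∀ h : c ∈ skewCells lam mu, T.entry ⟨c, h⟩ < M
  isLowerSet := by
    rintro ⟨i, j⟩ ⟨i', j'⟩ ⟨h1, h2⟩ hc
    simp only [Finset.coe_filter, Set.mem_ofPred_eq, YoungDiagram.mem_cells] at hc ⊢
    simp only at h1 h2
    refine ⟨lam.up_left_mem h1 h2 hc.1, fun h => ?_⟩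
    have h' := mem_skewCells.mp h
    have hm : (i', j) ∈ skewCells lam mu := mem_skewCells.mpr
      ⟨lam.up_left_mem h1 le_rfl hc.1, fun hm => h'.2 (mu.up_left_mem le_rfl h2 hm)⟩
    have hc' : (i, j) ∈ skewCells lam mu := mem_skewCells.mpr
      ⟨hc.1, fun hm => h'.2 (mu.up_left_mem h1 h2 hm)⟩
    exact ((T.row_weak ⟨_, h⟩ ⟨_, hm⟩ rfl h2).trans (T.col_weak ⟨_, hm⟩ ⟨_, hc'⟩ rfl h1)).trans_lt
      (hc.2 hc')

theorem RPP.mem_lower {lam mu : YoungDiagram} (T : RPP lam mu) (M : ℕ)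
    (c : ℕ × ℕ) : c ∈ T.lower M ↔
      c ∈ lam ∧ ∀ h : c ∈ skewCells lam mu, T.entry ⟨c, h⟩ < M := by
  rw [← YoungDiagram.mem_cells]
  simp only [RPP.lower, Finset.mem_filter, YoungDiagram.mem_cells]

open Classical in
-- Monotonicity makes the boxes with entry below `M`, together with `mu`, a diagram `nu`; the boxes
-- of `lam / nu` all contain `M`. Cutting there is inverse to `RPP.extend`.
theorem card_RPP_add_single {lam mu : YoungDiagram} (hle : mu ≤ lam) (n : ℕ →₀ ℕ) (M k : ℕ)
    (hn : ∀ i ∈ n.support, i < M) :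
    Nat.card {T : RPP lam mu // T.weight = n + Finsupp.single M k} =
      ∑ nu ∈ (between mu lam).filter (fun nu => ColStep k nu lam),
        Nat.card {T : RPP nu mu // T.weight = n} := by
  have hnM : n M = 0 := by
    by_contra h
    exact lt_irrefl _ (hn M (Finsupp.mem_support_iff.mpr h))
  have bound : ∀ {nu : YoungDiagram} (T : RPP nu mu), T.weight = n → ∀ c, T.entry c < M := by
    intro nu T hT c
    apply hn
    rw [Finsupp.mem_support_iff, ← hT, RPP.weight_ne_zero]
    exact ⟨c, rfl⟩
  have hmem : ∀ nu : {nu // nu ∈ (between mu lam).filter (fun nu => ColStep k nu lam)},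
      mu ≤ nu.1 ∧ nu.1 ≤ lam ∧ numCols lam nu.1 = k := by
    rintro ⟨nu, h⟩
    rw [Finset.mem_filter, mem_between] at h
    exact ⟨h.1.1, h.1.2, h.2.2⟩
  rw [← Finset.sum_coe_sort, ← Nat.card_sigma]
  symm
  refine Nat.card_congr (Equiv.ofBijective (fun p => ⟨p.2.1.extend M (bound p.2.1 p.2.2), ?_⟩)
    ⟨?_, ?_⟩)
  · rw [RPP.weight_extend (hmem p.1).1 (hmem p.1).2.1, p.2.2, (hmem p.1).2.2]
  -- Injectivity: the intermediate diagram can be read off from the extended filling.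
  · have recover : ∀ (nu : {nu // nu ∈ (between mu lam).filter (fun nu => ColStep k nu lam)})
        (T : {T : RPP nu.1 mu // T.weight = n}),
        (T.1.extend M (bound T.1 T.2) : RPP lam mu).lower M = nu.1 := by
      rintro nu T
      obtain ⟨h1, h2, -⟩ := hmem nu
      ext c
      rw [YoungDiagram.mem_cells, YoungDiagram.mem_cells, RPP.mem_lower]
      constructor
      · rintro ⟨h3, h4⟩
        by_contra h
        have h5 := h4 (mem_skewCells.mpr ⟨h3, fun h' => h (h1 h')⟩)
        simp only [RPP.extend] at h5
        rw [dif_neg fun h' => h (mem_skewCells.mp h').1] at h5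
        exact lt_irrefl _ h5
      · intro h
        refine ⟨h2 h, fun h' => ?_⟩
        simp only [RPP.extend]
        rw [dif_pos (mem_skewCells.mpr ⟨h, (mem_skewCells.mp h').2⟩)]
        exact bound T.1 T.2 _
    rintro ⟨nu, T⟩ ⟨nu', T'⟩ h
    have h' := congrArg Subtype.val h
    simp only at h'
    obtain rfl : nu = nu' := by
      apply Subtype.ext
      rw [← recover nu T, ← recover nu' T', h']
    congr 1
    refine Subtype.ext (RPP.ext' fun c => ?_)
    have hc := mem_skewCells.mp c.2
    have := congrFun (congrArg RPP.entry h')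
      ⟨c.1, mem_skewCells.mpr ⟨(hmem nu).2.1 hc.1, hc.2⟩⟩
    simp only [RPP.extend] at this
    rwa [dif_pos c.2, dif_pos c.2] at this
  · rintro ⟨T, hT⟩
    have hTM : ∀ c, T.entry c ≤ M := by
      intro c
      have : T.weight (T.entry c) ≠ 0 := (T.weight_ne_zero _).mpr ⟨c, rfl⟩
      rw [hT, Finsupp.add_apply] at this
      by_contra! h
      rw [Finsupp.single_eq_of_ne h.ne', add_zero] at this
      exact absurd (hn _ (Finsupp.mem_support_iff.mpr this)) (by omega)
    have h1 : mu ≤ T.lower M := fun c hc =>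
      (T.mem_lower M c).mpr ⟨hle hc, fun h => absurd hc (mem_skewCells.mp h).2⟩
    have h2 : T.lower M ≤ lam := fun c hc => ((T.mem_lower M c).mp hc).1
    have hsub : ∀ c, c ∈ skewCells (T.lower M) mu → c ∈ skewCells lam mu := fun c hc =>
      mem_skewCells.mpr ⟨h2 (mem_skewCells.mp hc).1, (mem_skewCells.mp hc).2⟩
    let T' : RPP (T.lower M) mu :=
      { entry := fun c => T.entry ⟨c.1, hsub c.1 c.2⟩
        row_weak := fun c d h1 h2 => T.row_weak _ _ h1 h2
        col_weak := fun c d h1 h2 => T.col_weak _ _ h1 h2 }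
    have hT' : ∀ c, T'.entry c < M := fun c =>
      ((T.mem_lower M c.1).mp (mem_skewCells.mp c.2).1).2 _
    have hext : (T'.extend M hT' : RPP lam mu) = T := by
      refine RPP.ext' fun c => ?_
      simp only [RPP.extend]
      split_ifs with h
      · rfl
      · have hc := mem_skewCells.mp c.2
        have h3 : c.1 ∉ T.lower M := fun h' => h (mem_skewCells.mpr ⟨h', hc.2⟩)
        rw [RPP.mem_lower] at h3
        push Not at h3
        obtain ⟨h4, h5⟩ := h3 hc.1
        exact le_antisymm h5 (hTM c)
    have hw := RPP.weight_extend h1 h2 T' M hT'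
    rw [hext, hT] at hw
    have hw' : T'.weight M = 0 := by
      by_contra h
      obtain ⟨c, hc⟩ := (T'.weight_ne_zero M).mp h
      exact absurd (hT' c) (by omega)
    -- `M` occurs neither in `n` nor in the lower part, so the `M`-th coordinates of the two weights
    -- are `k` and the number of columns.
    have hk : numCols lam (T.lower M) = k := by
      have := DFunLike.congr_fun hw M
      simp [hnM, hw'] at this
      exact this.symm
    have hTn : T'.weight = n := by
      rw [hk] at hw
      exact (add_right_cancel hw).symm
    refine ⟨⟨⟨T.lower M, ?_⟩, ⟨T', hTn⟩⟩, Subtype.ext hext⟩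
    rw [Finset.mem_filter, mem_between]
    exact ⟨⟨h1, h2⟩, h2, hk⟩

open Classical in
theorem card_RPP_zero {lam mu : YoungDiagram} (hle : mu ≤ lam) :
    Nat.card {T : RPP lam mu // T.weight = 0} = if mu = lam then 1 else 0 := by
  split_ifs with h
  · subst h
    have hempty : ∀ c : {c // c ∈ skewCells mu mu}, False := fun c =>
      (mem_skewCells.mp c.2).2 (mem_skewCells.mp c.2).1
    rw [Nat.card_eq_one_iff_unique]
    refine ⟨⟨fun T T' => Subtype.ext (RPP.ext' fun c => (hempty c).elim)⟩, ⟨⟨⟨fun _ => 0, ?_, ?_⟩,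
      ?_⟩⟩⟩
    · exact fun c => (hempty c).elim
    · exact fun c => (hempty c).elim
    · ext i
      by_contra h
      obtain ⟨c, -⟩ := (RPP.weight_ne_zero _ i).mp h
      exact hempty c
  · rw [Nat.card_eq_zero]
    left
    refine ⟨fun T => h ?_⟩
    refine le_antisymm hle fun c hc => ?_
    by_contra hc'
    have := (T.1.weight_ne_zero (T.1.entry ⟨c, mem_skewCells.mpr ⟨hc, hc'⟩⟩)).mpr ⟨_, rfl⟩
    rw [T.2] at this
    exact this rfl

/-- Removing the largest entry gives both sides the same recursion; the path count, unlike the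
tableau count, is visibly independent of the order of the variables. -/
theorem coeff_dualGroth (K : Type*) [CommRing K] {lam mu : YoungDiagram} (hle : mu ≤ lam)
    (n : ℕ →₀ ℕ) :
    MvPowerSeries.coeff n (dualGroth K lam mu) = pathElem K isSteps_colStep n mu lam := by
  classical
  refine eq_pathElem isSteps_colStep
    (g := fun lam n => MvPowerSeries.coeff n (dualGroth K lam mu)) ?_ ?_ lam hle n
  · intro lam hle
    change ((Nat.card _ : ℕ) : K) = _
    rw [card_RPP_zero hle]
    split_ifs <;> simp
  · intro lam hle n M k hM
    change ((Nat.card _ : ℕ) : K) = _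
    rw [card_RPP_add_single hle n M k hM, Nat.cast_sum]
    rfl

end Tableaux

/-! ### Removing the largest entries of a semistandard tableau -/

section Semistandard

theorem content_apply {lam : YoungDiagram} (T : SemistandardYoungTableau lam) (i : ℕ) :
    content T i = (lam.cells.filter fun c => T c.1 c.2 = i).card := by
  rw [content, Finsupp.finsetSum_apply, Finset.card_filter]
  exact Finset.sum_congr rfl fun p _ => Finsupp.single_apply

theorem content_ne_zero {lam : YoungDiagram} (T : SemistandardYoungTableau lam) (i : ℕ) :
    content T i ≠ 0 ↔ ∃ c ∈ lam, T c.1 c.2 = i := by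
  rw [content_apply, Finset.card_ne_zero]
  constructor
  · rintro ⟨c, hc⟩
    rw [Finset.mem_filter, YoungDiagram.mem_cells] at hc
    exact ⟨c, hc⟩
  · rintro ⟨c, hc⟩
    exact ⟨c, Finset.mem_filter.mpr ⟨(YoungDiagram.mem_cells c).mpr hc.1, hc.2⟩⟩

theorem degree_content {lam : YoungDiagram} (T : SemistandardYoungTableau lam) :
    (content T).degree = lam.card := by
  rw [content, map_sum]
  simp [YoungDiagram.card]

instance finite_content (lam : YoungDiagram) (n : ℕ →₀ ℕ) :
    Finite {T : SemistandardYoungTableau lam // content T = n} := by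
  refine Finite.of_injective (β := lam.cells → n.support)
    (fun T c => ⟨T.1 c.1.1 c.1.2, ?_⟩) ?_
  · have := (content_ne_zero T.1 _).mpr ⟨c.1, (YoungDiagram.mem_cells _).mp c.2, rfl⟩
    rwa [T.2, ← Finsupp.mem_support_iff] at this
  · intro T T' h
    refine Subtype.ext (SemistandardYoungTableau.ext fun i j => ?_)
    by_cases hc : (i, j) ∈ lam
    · exact congrArg Subtype.val (congrFun h ⟨(i, j), (YoungDiagram.mem_cells _).mpr hc⟩)
    · rw [T.1.zeros hc, T'.1.zeros hc]

/-- Fill the boxes of the horizontal strip `lam / nu` with `M`. -/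
def ssytExtend {lam nu : YoungDiagram} (hle : nu ≤ lam) (hs : IsStrip lam nu)
    (T : SemistandardYoungTableau nu) (M : ℕ)
    (hM : ∀ i j, (i, j) ∈ nu → T i j < M) : SemistandardYoungTableau lam where
  entry i j := if (i, j) ∈ nu then T i j else if (i, j) ∈ lam then M else 0
  row_weak' {i j1 j2} hj hc := by
    by_cases h2 : (i, j2) ∈ nu
    · have h1 := nu.up_left_mem le_rfl hj.le h2
      rw [if_pos h2, if_pos h1]
      exact T.row_weak hj h2
    · rw [if_neg h2, if_pos hc]
      split_ifs with h1 h1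
      · exact (hM _ _ h1).le
      · exact le_rfl
      · exact Nat.zero_le _
  col_strict' {i1 i2 j} hi hc := by
    by_cases h2 : (i2, j) ∈ nu
    · have h1 := nu.up_left_mem hi.le le_rfl h2
      rw [if_pos h2, if_pos h1]
      exact T.col_strict hi h2
    -- In a horizontal strip every box above a new box is old, hence has an entry below `M`.
    · have h1 : (i1, j) ∈ nu := by
        have := hs j
        rw [YoungDiagram.mem_iff_lt_colLen] at *
        omega
      rw [if_neg h2, if_pos hc, if_pos h1]
      exact hM _ _ h1
  zeros' {i j} h := by
    rw [if_neg fun h' => h (hle h'), if_neg h]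

theorem ssytExtend_apply {lam nu : YoungDiagram} (hle : nu ≤ lam) (hs : IsStrip lam nu)
    (T : SemistandardYoungTableau nu) (M : ℕ) (hM : ∀ i j, (i, j) ∈ nu → T i j < M) (i j : ℕ) :
    ssytExtend hle hs T M hM i j =
      if (i, j) ∈ nu then T i j else if (i, j) ∈ lam then M else 0 := rfl

theorem content_ssytExtend {lam nu : YoungDiagram} (hle : nu ≤ lam) (hs : IsStrip lam nu)
    (T : SemistandardYoungTableau nu) (M : ℕ) (hM : ∀ i j, (i, j) ∈ nu → T i j < M) :
    content (ssytExtend hle hs T M hM) =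
      content T + Finsupp.single M (lam.card - nu.card) := by
  have hsub := YoungDiagram.cells_subset_iff.mpr hle
  rw [content, ← Finset.sum_sdiff hsub, add_comm]
  congr 1
  · refine Finset.sum_congr rfl fun c hc => ?_
    rw [ssytExtend_apply, if_pos ((YoungDiagram.mem_cells c).mp hc)]
  · have h : ∀ c ∈ lam.cells \ nu.cells,
        Finsupp.single (ssytExtend hle hs T M hM c.1 c.2) 1 = Finsupp.single M 1 := by
      intro c hc
      rw [Finset.mem_sdiff, YoungDiagram.mem_cells, YoungDiagram.mem_cells] at hc
      rw [ssytExtend_apply, if_neg hc.2, if_pos hc.1]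
    rw [Finset.sum_congr rfl h, Finset.sum_const, Finset.card_sdiff_of_subset hsub,
      Finsupp.smul_single, smul_eq_mul, mul_one]

/-- The part of a semistandard tableau with entries less than `M`, as a diagram. -/
def ssytLower {lam : YoungDiagram} (T : SemistandardYoungTableau lam) (M : ℕ) :
    YoungDiagram where
  cells := lam.cells.filter fun c => T c.1 c.2 < M
  isLowerSet := by
    rintro ⟨i, j⟩ ⟨i', j'⟩ ⟨h1, h2⟩ hc
    simp only [Finset.coe_filter, Set.mem_ofPred_eq, YoungDiagram.mem_cells] at hc ⊢
    simp only at h1 h2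
    refine ⟨lam.up_left_mem h1 h2 hc.1, ?_⟩
    exact ((T.row_weak_of_le h2 (lam.up_left_mem h1 le_rfl hc.1)).trans
      (T.col_weak h1 hc.1)).trans_lt hc.2

theorem mem_ssytLower {lam : YoungDiagram} (T : SemistandardYoungTableau lam) (M : ℕ)
    (c : ℕ × ℕ) : c ∈ ssytLower T M ↔ c ∈ lam ∧ T c.1 c.2 < M := by
  rw [← YoungDiagram.mem_cells]
  simp only [ssytLower, Finset.mem_filter, YoungDiagram.mem_cells]

open Classical in
-- The cut is the same as for reverse plane partitions, but strict columns force the boxes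
-- containing `M` to form a horizontal strip, and the content counts boxes instead of columns.
theorem card_ssyt_add_single (lam : YoungDiagram) (n : ℕ →₀ ℕ) (M k : ℕ)
    (hn : ∀ i ∈ n.support, i < M) :
    Nat.card {T : SemistandardYoungTableau lam // content T = n + Finsupp.single M k} =
      ∑ nu ∈ (between ⊥ lam).filter (fun nu => StripStep k nu lam),
        Nat.card {T : SemistandardYoungTableau nu // content T = n} := by
  have hnM : n M = 0 := by
    by_contra h
    exact lt_irrefl _ (hn M (Finsupp.mem_support_iff.mpr h))
  have bound : ∀ {nu : YoungDiagram} (T : SemistandardYoungTableau nu), content T = n →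
      ∀ i j, (i, j) ∈ nu → T i j < M := by
    intro nu T hT i j hc
    apply hn
    rw [Finsupp.mem_support_iff, ← hT, content_ne_zero]
    exact ⟨(i, j), hc, rfl⟩
  have hmem : ∀ nu : {nu // nu ∈ (between ⊥ lam).filter (fun nu => StripStep k nu lam)},
      nu.1 ≤ lam ∧ IsStrip lam nu.1 ∧ lam.card = nu.1.card + k := by
    rintro ⟨nu, h⟩
    rw [Finset.mem_filter] at h
    exact h.2
  rw [← Finset.sum_coe_sort, ← Nat.card_sigma]
  symm
  refine Nat.card_congr (Equiv.ofBijective (fun p =>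
    ⟨ssytExtend (hmem p.1).1 (hmem p.1).2.1 p.2.1 M (bound p.2.1 p.2.2), ?_⟩) ⟨?_, ?_⟩)
  · rw [content_ssytExtend, p.2.2, (hmem p.1).2.2, Nat.add_sub_cancel_left]
  · have recover : ∀ (nu : {nu // nu ∈ (between ⊥ lam).filter (fun nu => StripStep k nu lam)})
        (T : {T : SemistandardYoungTableau nu.1 // content T = n}),
        ssytLower (ssytExtend (hmem nu).1 (hmem nu).2.1 T.1 M (bound T.1 T.2)) M = nu.1 := by
      rintro nu T
      ext c
      rw [YoungDiagram.mem_cells, YoungDiagram.mem_cells, mem_ssytLower, ssytExtend_apply]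
      constructor
      · rintro ⟨h3, h4⟩
        by_contra h
        rw [if_neg h, if_pos h3] at h4
        exact lt_irrefl _ h4
      · intro h
        refine ⟨(hmem nu).1 h, ?_⟩
        rw [if_pos h]
        exact bound T.1 T.2 _ _ h
    rintro ⟨nu, T⟩ ⟨nu', T'⟩ h
    have h' := congrArg Subtype.val h
    simp only at h'
    obtain rfl : nu = nu' := by
      apply Subtype.ext
      rw [← recover nu T, ← recover nu' T', h']
    congr 1
    refine Subtype.ext (SemistandardYoungTableau.ext fun i j => ?_)
    by_cases hc : (i, j) ∈ nu.1
    · have := DFunLike.congr_fun h' i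
      have := congrFun this j
      rwa [ssytExtend_apply, ssytExtend_apply, if_pos hc, if_pos hc] at this
    · rw [T.1.zeros hc, T'.1.zeros hc]
  · rintro ⟨T, hT⟩
    have hTM : ∀ i j, (i, j) ∈ lam → T i j ≤ M := by
      intro i j hc
      have : content T (T i j) ≠ 0 := (content_ne_zero T _).mpr ⟨(i, j), hc, rfl⟩
      rw [hT, Finsupp.add_apply] at this
      by_contra! h
      rw [Finsupp.single_eq_of_ne h.ne', add_zero] at this
      exact absurd (hn _ (Finsupp.mem_support_iff.mpr this)) (by omega)
    have h2 : ssytLower T M ≤ lam := fun c hc => ((mem_ssytLower T M c).mp hc).1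
    -- Of two removed boxes in one column the upper has entry at least `M`, so the lower would
    -- exceed the maximum `M`.
    have hs : IsStrip lam (ssytLower T M) := by
      intro j
      by_contra! h
      set r := (ssytLower T M).colLen j
      have h3 : (r + 1, j) ∈ lam := YoungDiagram.mem_iff_lt_colLen.mpr h
      have h4 : (r, j) ∈ lam := lam.up_left_mem (Nat.le_succ r) le_rfl h3
      have h5 : (r, j) ∉ ssytLower T M := by
        rw [YoungDiagram.mem_iff_lt_colLen]
        exact lt_irrefl _
      rw [mem_ssytLower] at h5
      have h6 : T r j < T (r + 1) j := T.col_strict (Nat.lt_succ_self r) h3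
      have h7 : T (r + 1) j ≤ M := hTM _ _ h3
      exact h5 ⟨h4, by simp only; omega⟩
    let T' : SemistandardYoungTableau (ssytLower T M) :=
      { entry := fun i j => if (i, j) ∈ ssytLower T M then T i j else 0
        row_weak' := fun {i j1 j2} h hc => by
          rw [if_pos hc, if_pos ((ssytLower T M).up_left_mem le_rfl h.le hc)]
          exact T.row_weak h (h2 hc)
        col_strict' := fun {i j1 j2} h hc => by
          rw [if_pos hc, if_pos ((ssytLower T M).up_left_mem h.le le_rfl hc)]
          exact T.col_strict h (h2 hc)
        zeros' := fun {i j} h => if_neg h }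
    have hT'a : ∀ i j, T' i j = if (i, j) ∈ ssytLower T M then T i j else 0 := fun _ _ => rfl
    have hT' : ∀ i j, (i, j) ∈ ssytLower T M → T' i j < M := by
      intro i j hc
      rw [hT'a, if_pos hc]
      exact ((mem_ssytLower T M _).mp hc).2
    have hext : ssytExtend h2 hs T' M hT' = T := by
      refine SemistandardYoungTableau.ext fun i j => ?_
      rw [ssytExtend_apply]
      split_ifs with h h'
      · rw [hT'a, if_pos h]
      · rw [mem_ssytLower, not_and, not_lt] at h
        exact le_antisymm (h h') (hTM _ _ h')
      · rw [T.zeros h']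
    have hw := content_ssytExtend h2 hs T' M hT'
    rw [hext, hT] at hw
    have hw' : content T' M = 0 := by
      by_contra h
      obtain ⟨c, hc, hcM⟩ := (content_ne_zero T' M).mp h
      exact absurd (hT' c.1 c.2 hc) (by omega)
    have hk : lam.card - (ssytLower T M).card = k := by
      have := DFunLike.congr_fun hw M
      simp [hnM, hw'] at this
      exact this.symm
    have hTn : content T' = n := by
      rw [hk] at hw
      exact (add_right_cancel hw).symm
    refine ⟨⟨⟨ssytLower T M, ?_⟩, ⟨T', hTn⟩⟩, Subtype.ext hext⟩
    rw [Finset.mem_filter, mem_between]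
    have := card_mono h2
    exact ⟨⟨bot_le, h2⟩, h2, hs, by omega⟩

open Classical in
theorem card_ssyt_zero (lam : YoungDiagram) :
    Nat.card {T : SemistandardYoungTableau lam // content T = 0} = if ⊥ = lam then 1 else 0 := by
  split_ifs with h
  · subst h
    rw [Nat.card_eq_one_iff_unique]
    refine ⟨⟨fun T T' => Subtype.ext (SemistandardYoungTableau.ext fun i j => ?_)⟩,
      ⟨⟨default, ?_⟩⟩⟩
    · rw [T.1.zeros (YoungDiagram.notMem_bot _), T'.1.zeros (YoungDiagram.notMem_bot _)]
    · simp [content]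
  · rw [Nat.card_eq_zero]
    left
    refine ⟨fun T => h ?_⟩
    refine le_antisymm bot_le fun c hc => ?_
    have := (content_ne_zero T.1 _).mpr ⟨c, hc, rfl⟩
    rw [T.2] at this
    exact absurd rfl this

theorem coeff_schur (K : Type*) [CommRing K] (lam : YoungDiagram) (n : ℕ →₀ ℕ) :
    MvPowerSeries.coeff n (schur K lam) = pathElem K isSteps_stripStep n ⊥ lam := by
  classical
  refine eq_pathElem isSteps_stripStep
    (g := fun lam n => MvPowerSeries.coeff n (schur K lam)) ?_ ?_ lam bot_le n
  · intro lam _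
    change ((Nat.card _ : ℕ) : K) = _
    rw [card_ssyt_zero]
    split_ifs <;> simp
  · intro lam _ n M k hM
    change ((Nat.card _ : ℕ) : K) = _
    rw [card_ssyt_add_single lam n M k hM, Nat.cast_sum]
    rfl

end Semistandard

/-! ### Symmetric power series in terms of coefficients -/

section Symmetric

variable {K : Type*} [CommRing K]

theorem coeff_rename_equiv {α β : Type*} (e : α ≃ β) (f : MvPowerSeries α K) (n : α →₀ ℕ) :
    MvPowerSeries.coeff (n.mapDomain e) (MvPowerSeries.rename (R := K) e f) =
      MvPowerSeries.coeff n f := by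
  have h := MvPowerSeries.coeff_embDomain_rename e.toEmbedding f n
  rw [Finsupp.embDomain_eq_mapDomain] at h
  exact h

theorem mem_symSeries_iff {f : MvPowerSeries ℕ K} :
    f ∈ SymSeries K ↔ ∀ (σ : Equiv.Perm ℕ) (n : ℕ →₀ ℕ),
      MvPowerSeries.coeff (n.mapDomain σ) f = MvPowerSeries.coeff n f := by
  rw [SymSeries, Algebra.mem_iInf]
  refine forall_congr' fun σ => ?_
  rw [AlgHom.mem_equalizer]
  constructor
  · intro h n
    rw [← coeff_rename_equiv σ f n]
    exact congrArg _ h.symm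
  · intro h
    ext m
    obtain ⟨n, rfl⟩ : ∃ n : ℕ →₀ ℕ, n.mapDomain σ = m :=
      ⟨m.mapDomain σ.symm, by rw [← Finsupp.mapDomain_comp]; simp [Finsupp.mapDomain_id]⟩
    rw [coeff_rename_equiv, AlgHom.id_apply, h]

theorem coeff_schur_eq_zero {lam : YoungDiagram} {n : ℕ →₀ ℕ} (h : n.degree ≠ lam.card) :
    MvPowerSeries.coeff n (schur K lam) = 0 := by
  have : IsEmpty {T : SemistandardYoungTableau lam // content T = n} :=
    ⟨fun T => h (by rw [← T.2, degree_content])⟩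
  change ((Nat.card _ : ℕ) : K) = 0
  rw [Nat.card_of_isEmpty, Nat.cast_zero]

theorem schur_mem (lam : YoungDiagram) : schur K lam ∈ Sym K := by
  refine ⟨mem_symSeries_iff.mpr fun σ n => ?_, lam.card, fun n hn => coeff_schur_eq_zero hn.ne'⟩
  rw [coeff_schur, coeff_schur, pathElem_mapDomain _ σ.injective]

theorem degree_weight_le {lam mu : YoungDiagram} (T : RPP lam mu) :
    T.weight.degree ≤ lam.card := by
  rw [RPP.weight, map_sum]
  simp only [Finsupp.degree_single, Finset.sum_const, smul_eq_mul, mul_one]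
  refine Finset.card_image_le.trans ?_
  rw [Finset.card_univ, Fintype.card_coe]
  exact Finset.card_le_card Finset.sdiff_subset

theorem dualGroth_mem {lam mu : YoungDiagram} (hle : mu ≤ lam) : dualGroth K lam mu ∈ Sym K := by
  refine ⟨mem_symSeries_iff.mpr fun σ n => ?_, lam.card, fun n hn => ?_⟩
  · rw [coeff_dualGroth K hle, coeff_dualGroth K hle, pathElem_mapDomain _ σ.injective]
  · have : IsEmpty {T : RPP lam mu // T.weight = n} :=
      ⟨fun T => absurd (degree_weight_le T.1) (by rw [T.2]; omega)⟩
    change ((Nat.card _ : ℕ) : K) = 0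
    rw [Nat.card_of_isEmpty, Nat.cast_zero]

end Symmetric

/-! ### The expansion of a symmetric power series in Schur functions -/

section Expansion

/-- The sum of the row indices of the boxes of a diagram. -/
def rowIndexSum (lam : YoungDiagram) : ℕ := ∑ c ∈ lam.cells, c.1

/-- The exponent whose entries are the row lengths of a diagram. -/
noncomputable def rowContent (mu : YoungDiagram) : ℕ →₀ ℕ :=
  content (SemistandardYoungTableau.highestWeight mu)

theorem rowContent_apply (mu : YoungDiagram) (i : ℕ) : rowContent mu i = mu.rowLen i := by
  rw [rowContent, content_apply, YoungDiagram.rowLen_eq_card]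
  congr 1
  ext ⟨a, b⟩
  rw [Finset.mem_filter, YoungDiagram.mem_cells, YoungDiagram.mem_row_iff,
    SemistandardYoungTableau.highestWeight_apply]
  refine and_congr_right fun h => ?_
  rw [if_pos h]

theorem degree_rowContent (mu : YoungDiagram) : (rowContent mu).degree = mu.card :=
  degree_content _

theorem rowContent_injective : Function.Injective rowContent := by
  intro lam mu h
  ext ⟨i, j⟩
  rw [YoungDiagram.mem_cells, YoungDiagram.mem_cells, YoungDiagram.mem_iff_lt_rowLen,
    YoungDiagram.mem_iff_lt_rowLen, ← rowContent_apply, ← rowContent_apply, h]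

theorem exists_rowContent_eq {n : ℕ →₀ ℕ} (h : ∀ i, n (i + 1) ≤ n i) :
    ∃ mu, rowContent mu = n := by
  have hanti : Antitone n := antitone_nat_of_succ_le h
  let mu : YoungDiagram :=
    { cells := n.support.biUnion fun i => {i} ×ˢ Finset.range (n i)
      isLowerSet := by
        rintro ⟨i, j⟩ ⟨i', j'⟩ ⟨h1, h2⟩ hc
        simp only at h1 h2
        simp only [Finset.mem_coe, Finset.mem_biUnion, Finsupp.mem_support_iff,
          Finset.mem_product, Finset.mem_singleton, Finset.mem_range] at hc ⊢
        obtain ⟨_, h3, rfl, h4⟩ := hc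
        have := hanti h1
        exact ⟨i', by omega, rfl, by omega⟩ }
  have hmem : ∀ i j, (i, j) ∈ mu ↔ j < n i := by
    intro i j
    rw [← YoungDiagram.mem_cells]
    simp only [mu, Finset.mem_biUnion, Finsupp.mem_support_iff, Finset.mem_product,
      Finset.mem_singleton, Finset.mem_range]
    constructor
    · rintro ⟨_, _, rfl, h⟩
      exact h
    · intro h
      exact ⟨i, by omega, rfl, h⟩
  refine ⟨mu, Finsupp.ext fun i => ?_⟩
  rw [rowContent_apply]
  have h1 := hmem i (n i)
  have h2 := hmem i (mu.rowLen i)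
  rw [YoungDiagram.mem_iff_lt_rowLen] at h1 h2
  omega

/-- The functional n ↦ ∑ i n_i orders the exponents in the triangularity argument. -/
theorem weight_content {lam : YoungDiagram} (T : SemistandardYoungTableau lam) :
    Finsupp.weight (id : ℕ → ℕ) (content T) = ∑ c ∈ lam.cells, T c.1 c.2 := by
  rw [content, map_sum]
  refine Finset.sum_congr rfl fun c _ => ?_
  simp [Finsupp.weight_apply]

theorem row_le_entry {lam : YoungDiagram} (T : SemistandardYoungTableau lam) (i j : ℕ)
    (h : (i, j) ∈ lam) : i ≤ T i j := by
  induction i with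
  | zero => exact Nat.zero_le _
  | succ i ih =>
    have h1 := ih (lam.up_left_mem (Nat.le_succ i) le_rfl h)
    have h2 := T.col_strict (Nat.lt_succ_self i) h
    exact Nat.succ_le_of_lt (h1.trans_lt h2)

theorem weight_rowContent (mu : YoungDiagram) :
    Finsupp.weight (id : ℕ → ℕ) (rowContent mu) = rowIndexSum mu := by
  rw [rowContent, weight_content]
  refine Finset.sum_congr rfl fun c hc => ?_
  rw [SemistandardYoungTableau.highestWeight_apply, if_pos ((YoungDiagram.mem_cells _).mp hc)]

/-- Entries are at least their row index, so their sum, which is `rowIndexSum mu`, is at least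
`rowIndexSum lam`; equality forces every entry to equal its row index. -/
theorem eq_highestWeight_of_content {lam mu : YoungDiagram} (T : SemistandardYoungTableau lam)
    (hT : content T = rowContent mu) (h : rowIndexSum mu ≤ rowIndexSum lam) :
    T = SemistandardYoungTableau.highestWeight lam := by
  rw [← weight_rowContent mu, ← hT, weight_content, rowIndexSum] at h
  have hle : ∀ c ∈ lam.cells, c.1 ≤ T c.1 c.2 := fun c hc =>
    row_le_entry T c.1 c.2 ((YoungDiagram.mem_cells _).mp hc)
  have heq := (Finset.sum_eq_sum_iff_of_le hle).mp (le_antisymm (Finset.sum_le_sum hle) h)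
  ext i j
  rw [SemistandardYoungTableau.highestWeight_apply]
  split_ifs with hc
  · exact (heq (i, j) ((YoungDiagram.mem_cells _).mpr hc)).symm
  · exact T.zeros hc

variable {K : Type*} [CommRing K]

theorem coeff_rowContent_schur_self (mu : YoungDiagram) :
    MvPowerSeries.coeff (rowContent mu) (schur K mu) = 1 := by
  have h : Nat.card {T : SemistandardYoungTableau mu // content T = rowContent mu} = 1 := by
    rw [Nat.card_eq_one_iff_unique]
    refine ⟨⟨fun T T' => Subtype.ext ?_⟩, ⟨⟨_, rfl⟩⟩⟩
    rw [eq_highestWeight_of_content T.1 T.2 le_rfl, eq_highestWeight_of_content T'.1 T'.2 le_rfl]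
  change ((Nat.card _ : ℕ) : K) = 1
  rw [h, Nat.cast_one]

theorem coeff_rowContent_schur_eq_zero {lam mu : YoungDiagram} (hne : lam ≠ mu)
    (h : rowIndexSum mu ≤ rowIndexSum lam) :
    MvPowerSeries.coeff (rowContent mu) (schur K lam) = 0 := by
  have : IsEmpty {T : SemistandardYoungTableau lam // content T = rowContent mu} := by
    refine ⟨fun T => hne (rowContent_injective ?_)⟩
    have := T.2
    rwa [eq_highestWeight_of_content T.1 T.2 h] at this
  change ((Nat.card _ : ℕ) : K) = 0
  rw [Nat.card_of_isEmpty, Nat.cast_zero]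

theorem finite_card_eq (d : ℕ) : {lam : YoungDiagram | lam.card = d}.Finite := by
  refine Set.Finite.of_finite_image (f := YoungDiagram.cells)
    (Set.Finite.subset (Finset.range d ×ˢ Finset.range d).powerset.finite_toSet ?_) ?_
  · rintro _ ⟨lam, rfl, rfl⟩
    rw [Finset.mem_coe, Finset.mem_powerset]
    rintro ⟨i, j⟩ hc
    rw [YoungDiagram.mem_cells] at hc
    rw [Finset.mem_product, Finset.mem_range, Finset.mem_range]
    have h1 := YoungDiagram.mem_iff_lt_colLen.mp hc
    have h2 := YoungDiagram.mem_iff_lt_rowLen.mp hc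
    rw [YoungDiagram.colLen_eq_card] at h1
    rw [YoungDiagram.rowLen_eq_card] at h2
    exact ⟨h1.trans_le (Finset.card_le_card (Finset.filter_subset _ _)),
      h2.trans_le (Finset.card_le_card (Finset.filter_subset _ _))⟩
  · intro a _ b _ h
    exact YoungDiagram.ext h

/-- The finite set of the diagrams with `d` boxes. -/
noncomputable def ofCard (d : ℕ) : Finset YoungDiagram := (finite_card_eq d).toFinset

theorem mem_ofCard {d : ℕ} {lam : YoungDiagram} : lam ∈ ofCard d ↔ lam.card = d := by
  simp [ofCard]

theorem coeff_schurSum (A : YoungDiagram → K) (n : ℕ →₀ ℕ) :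
    MvPowerSeries.coeff n (schurSum A) =
      ∑ lam ∈ ofCard n.degree, A lam * MvPowerSeries.coeff n (schur K lam) := by
  refine finsum_eq_sum_of_support_subset _ fun lam h => ?_
  rw [Finset.mem_coe, mem_ofCard]
  by_contra hne
  exact h (by simp only [coeff_schur_eq_zero (Ne.symm hne), mul_zero])

theorem schurSum_mem (A : YoungDiagram → K) : schurSum A ∈ SymSeries K := by
  refine mem_symSeries_iff.mpr fun σ n => ?_
  rw [coeff_schurSum, coeff_schurSum, Finsupp.degree_mapDomain]
  refine Finset.sum_congr rfl fun lam _ => ?_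
  rw [mem_symSeries_iff.mp (schur_mem lam).1]

theorem schurSum_add (A B : YoungDiagram → K) : schurSum (A + B) = schurSum A + schurSum B := by
  ext n
  simp only [map_add, coeff_schurSum, Pi.add_apply, add_mul, Finset.sum_add_distrib]

theorem schurSum_smul (r : K) (A : YoungDiagram → K) : schurSum (r • A) = r • schurSum A := by
  ext n
  simp only [map_smul, coeff_schurSum, Pi.smul_apply, smul_eq_mul, Finset.mul_sum, mul_assoc]

theorem coeff_rowContent_schurSum (A : YoungDiagram → K) (mu : YoungDiagram) :
    MvPowerSeries.coeff (rowContent mu) (schurSum A) = A mu +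
      ∑ lam ∈ ofCard mu.card, if rowIndexSum lam < rowIndexSum mu then
        A lam * MvPowerSeries.coeff (rowContent mu) (schur K lam) else 0 := by
  classical
  rw [coeff_schurSum, degree_rowContent]
  have hmu : mu ∈ ofCard mu.card := mem_ofCard.mpr rfl
  rw [← Finset.add_sum_erase _ _ hmu, ← Finset.add_sum_erase _ _ hmu, if_neg (lt_irrefl _),
    zero_add, coeff_rowContent_schur_self, mul_one]
  congr 1
  refine Finset.sum_congr rfl fun lam hlam => ?_
  split_ifs with h
  · rfl
  · rw [coeff_rowContent_schur_eq_zero (Finset.ne_of_mem_erase hlam) (not_lt.mp h), mul_zero]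

/-- The solution of the triangular system that determines a Schur expansion. -/
noncomputable def solveSchur (b : YoungDiagram → K) (mu : YoungDiagram) : K :=
  b mu - ∑ lam ∈ ofCard mu.card, if _h : rowIndexSum lam < rowIndexSum mu then
    solveSchur b lam * MvPowerSeries.coeff (rowContent mu) (schur K lam) else 0
termination_by rowIndexSum mu

theorem coeff_rowContent_solveSchur (b : YoungDiagram → K) (mu : YoungDiagram) :
    MvPowerSeries.coeff (rowContent mu) (schurSum (solveSchur b)) = b mu := by
  rw [coeff_rowContent_schurSum, solveSchur]
  simp only [dite_eq_ite, sub_add_cancel]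

/-- By unitriangularity, the coefficient at `rowContent mu` determines `A mu` once the values at
diagrams of smaller `rowIndexSum` are known to vanish. -/
theorem schurSum_injective : Function.Injective (schurSum (K := K)) := by
  suffices h : ∀ A : YoungDiagram → K, schurSum A = 0 → A = 0 by
    intro A B hAB
    refine sub_eq_zero.mp (h _ ?_)
    rw [sub_eq_add_neg, ← neg_one_smul K B, schurSum_add, schurSum_smul, hAB, neg_one_smul,
      add_neg_cancel]
  intro A hA
  funext mu
  induction h : rowIndexSum mu using Nat.strong_induction_on generalizing mu with
  | _ m ih =>
    have := coeff_rowContent_schurSum A mu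
    rw [hA, map_zero, Finset.sum_eq_zero, add_zero] at this
    · exact this.symm
    · intro lam _
      split_ifs with hlt
      · rw [ih _ (h ▸ hlt) lam rfl, Pi.zero_apply, zero_mul]
      · rfl

/-- The swap moves the larger exponent to the smaller index. This makes sorting an exponent by
adjacent swaps terminate. -/
theorem weight_mapDomain_swap_lt {n : ℕ →₀ ℕ} {i : ℕ} (h : n i < n (i + 1)) :
    Finsupp.weight (id : ℕ → ℕ) (n.mapDomain (Equiv.swap i (i + 1))) <
      Finsupp.weight (id : ℕ → ℕ) n := by
  set m := (n.erase i).erase (i + 1) with hm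
  have h1 : n = m + Finsupp.single (i + 1) (n (i + 1)) + Finsupp.single i (n i) := by
    have e1 := Finsupp.erase_add_single i n
    have e2 := Finsupp.erase_add_single (i + 1) (n.erase i)
    rw [Finsupp.erase_ne (Nat.succ_ne_self i)] at e2
    rw [hm, e2, e1]
  have h2 : m.mapDomain (Equiv.swap i (i + 1)) = m := by
    conv_rhs => rw [← Finsupp.mapDomain_id (v := m)]
    refine Finsupp.mapDomain_congr fun x hx => ?_
    rw [Finsupp.mem_support_iff] at hx
    refine Equiv.swap_apply_of_ne_of_ne ?_ ?_
    · rintro rfl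
      exact hx (by rw [hm, Finsupp.erase_ne (Nat.succ_ne_self x).symm, Finsupp.erase_same])
    · rintro rfl
      exact hx (by rw [hm, Finsupp.erase_same])
  generalize n i = a at *
  generalize n (i + 1) = b at *
  rw [h1, Finsupp.mapDomain_add, Finsupp.mapDomain_add, h2, Finsupp.mapDomain_single,
    Finsupp.mapDomain_single, Equiv.swap_apply_left, Equiv.swap_apply_right]
  simp only [map_add, Finsupp.weight_single, id, smul_eq_mul]
  nlinarith

theorem symSeries_eq_zero {f : MvPowerSeries ℕ K} (hf : f ∈ SymSeries K)
    (h : ∀ mu, MvPowerSeries.coeff (rowContent mu) f = 0) : f = 0 := by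
  ext n
  rw [map_zero]
  induction hw : Finsupp.weight (id : ℕ → ℕ) n using Nat.strong_induction_on generalizing n with
  | _ w ih =>
    by_cases hn : ∀ i, n (i + 1) ≤ n i
    · obtain ⟨mu, rfl⟩ := exists_rowContent_eq hn
      exact h mu
    · push Not at hn
      obtain ⟨i, hi⟩ := hn
      rw [← mem_symSeries_iff.mp hf (Equiv.swap i (i + 1)) n]
      exact ih _ (hw ▸ weight_mapDomain_swap_lt hi) _ rfl

/-- The triangular system matches the coefficients of `f` at all partition exponents, and these
determine a symmetric series. -/
theorem exists_schurSum {f : MvPowerSeries ℕ K} (hf : f ∈ SymSeries K) :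
    ∃ A : YoungDiagram → K, schurSum A = f := by
  refine ⟨solveSchur fun mu => MvPowerSeries.coeff (rowContent mu) f, ?_⟩
  refine sub_eq_zero.mp (symSeries_eq_zero (sub_mem (schurSum_mem _) hf) fun mu => ?_)
  rw [map_sub, coeff_rowContent_solveSchur, sub_self]

theorem schurSum_schurCoeff {f : MvPowerSeries ℕ K} (hf : f ∈ SymSeries K) :
    schurSum (schurCoeff f) = f := by
  rw [schurCoeff, dif_pos (exists_schurSum hf)]
  exact (exists_schurSum hf).choose_spec

theorem schurCoeff_schurSum (A : YoungDiagram → K) : schurCoeff (schurSum A) = A :=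
  schurSum_injective (schurSum_schurCoeff (schurSum_mem A))

/-- Schur functions are homogeneous, so truncating the expansion at degree `d` still gives `f`;
uniqueness of the expansion concludes. -/
theorem schurCoeff_eq_zero {f : MvPowerSeries ℕ K} (hf : f ∈ SymSeries K) {d : ℕ}
    (hd : ∀ n : ℕ →₀ ℕ, d < n.degree → MvPowerSeries.coeff n f = 0) {lam : YoungDiagram}
    (h : d < lam.card) : schurCoeff f lam = 0 := by
  have key : schurSum (fun lam => if lam.card ≤ d then schurCoeff f lam else 0) = f := by
    ext n
    rw [coeff_schurSum]
    by_cases hn : n.degree ≤ d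
    · conv_rhs => rw [← schurSum_schurCoeff hf, coeff_schurSum]
      refine Finset.sum_congr rfl fun lam hlam => ?_
      rw [mem_ofCard] at hlam
      rw [if_pos (hlam ▸ hn)]
    · rw [hd n (by omega)]
      refine Finset.sum_eq_zero fun lam hlam => ?_
      rw [mem_ofCard] at hlam
      rw [if_neg (hlam ▸ hn), zero_mul]
  rw [← key, schurCoeff_schurSum, if_neg (by omega)]

theorem schurCoeff_add {f g : MvPowerSeries ℕ K} (hf : f ∈ SymSeries K) (hg : g ∈ SymSeries K) :
    schurCoeff (f + g) = schurCoeff f + schurCoeff g :=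
  schurSum_injective (by
    rw [schurSum_add, schurSum_schurCoeff hf, schurSum_schurCoeff hg,
      schurSum_schurCoeff (add_mem hf hg)])

theorem schurCoeff_smul (r : K) {f : MvPowerSeries ℕ K} (hf : f ∈ SymSeries K) :
    schurCoeff (r • f) = r • schurCoeff f :=
  schurSum_injective (by
    rw [schurSum_smul, schurSum_schurCoeff hf,
      schurSum_schurCoeff (Subalgebra.smul_mem _ hf r)])

theorem finite_support_schurCoeff (f : Sym K) :
    (Function.support (schurCoeff (f : MvPowerSeries ℕ K))).Finite := by
  classical
  obtain ⟨hf, d, hd⟩ := f.2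
  refine Set.Finite.subset ((Finset.range (d + 1)).biUnion ofCard).finite_toSet fun lam h => ?_
  rw [Finset.mem_coe, Finset.mem_biUnion]
  refine ⟨lam.card, ?_, mem_ofCard.mpr rfl⟩
  rw [Finset.mem_range]
  by_contra! hlt
  exact h (schurCoeff_eq_zero hf hd (by omega))

theorem finite_support_hall (F : SymSeries K) (f : Sym K) : (Function.support fun lam =>
    schurCoeff (F : MvPowerSeries ℕ K) lam * schurCoeff (f : MvPowerSeries ℕ K) lam).Finite :=
  (finite_support_schurCoeff f).subset fun _ h h' => h (by simp only [h', mul_zero])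

theorem isLinearMap_hall (F : SymSeries K) : IsLinearMap K (hall F) where
  map_add f g := by
    rw [hall, hall, hall,
      ← finsum_add_distrib (finite_support_hall F f) (finite_support_hall F g)]
    refine finsum_congr fun lam => ?_
    rw [Subalgebra.coe_add, schurCoeff_add f.2.1 g.2.1, Pi.add_apply, mul_add]
  map_smul r f := by
    rw [hall, hall, smul_eq_mul, mul_finsum' _ _ (finite_support_hall F f)]
    refine finsum_congr fun lam => ?_
    rw [Subalgebra.coe_smul, schurCoeff_smul r f.2.1, Pi.smul_apply, smul_eq_mul,
      mul_left_comm]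

theorem hallLin_apply (F : SymSeries K) (f : Sym K) : hallLin F f = hall F f := by
  rw [hallLin, dif_pos (isLinearMap_hall F)]
  rfl

end Expansion

/-! ### The Hall inner product with the complete homogeneous symmetric functions -/

section CompleteHall

/-- The diagram with a single row of length `k`. -/
def rowDiagram (k : ℕ) : YoungDiagram where
  cells := {0} ×ˢ Finset.range k
  isLowerSet := by
    rintro ⟨i, j⟩ ⟨i', j'⟩ ⟨h1, h2⟩ hc
    simp only [Finset.coe_product, Finset.coe_singleton, Set.mem_prod, Set.mem_singleton_iff,
      Finset.mem_coe, Finset.mem_range] at hc h1 h2 ⊢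
    omega

theorem mem_rowDiagram {k i j : ℕ} : (i, j) ∈ rowDiagram k ↔ i = 0 ∧ j < k := by
  rw [← YoungDiagram.mem_cells]
  simp [rowDiagram, and_comm, eq_comm]

theorem card_rowDiagram (k : ℕ) : (rowDiagram k).card = k := by
  simp [YoungDiagram.card, rowDiagram]

theorem isStrip_bot_iff {lam : YoungDiagram} : IsStrip lam ⊥ ↔ lam = rowDiagram lam.card := by
  have key : ∀ {lam : YoungDiagram}, IsStrip lam ⊥ → lam = rowDiagram (lam.rowLen 0) := by
    intro lam h
    ext ⟨i, j⟩
    rw [YoungDiagram.mem_cells, YoungDiagram.mem_cells, mem_rowDiagram]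
    have h1 := h j
    have h0 : (⊥ : YoungDiagram).colLen j = 0 := eq_colLen_of_mem_iff fun i => by
      simp [YoungDiagram.notMem_bot]
    rw [← YoungDiagram.mem_iff_lt_rowLen]
    constructor
    · intro hc
      have h2 := YoungDiagram.mem_iff_lt_colLen.mp hc
      obtain rfl : i = 0 := by omega
      exact ⟨rfl, hc⟩
    · rintro ⟨rfl, hc⟩
      exact hc
  constructor
  · intro h
    have h1 := key h
    have h2 := congrArg YoungDiagram.card h1
    rw [card_rowDiagram] at h2
    rwa [h2]
  · intro h j
    rw [h]
    have : (rowDiagram lam.card).colLen j ≤ 1 := by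
      by_contra! h1
      have := mem_rowDiagram.mp (YoungDiagram.mem_iff_lt_colLen.mpr h1)
      omega
    omega

theorem rowDiagram_injective : Function.Injective rowDiagram := fun a b h => by
  rw [← card_rowDiagram a, h, card_rowDiagram]

theorem eq_rowDiagram_of_le {nu : YoungDiagram} {m : ℕ} (h : nu ≤ rowDiagram m) :
    nu = rowDiagram nu.card := by
  rw [← isStrip_bot_iff]
  have h1 : IsStrip (rowDiagram m) ⊥ := by rw [isStrip_bot_iff, card_rowDiagram]
  exact fun j => (le_iff_colLen_le.mp h j).trans (h1 j)

theorem rowDiagram_mono {k m : ℕ} (h : k ≤ m) : rowDiagram k ≤ rowDiagram m := by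
  rintro ⟨i, j⟩ hc
  have := mem_rowDiagram.mp hc
  exact mem_rowDiagram.mpr ⟨this.1, this.2.trans_le h⟩

variable {K : Type*} [CommRing K]

open Classical in
-- Only one step is taken, from the empty diagram, so `lam` itself must be a horizontal strip of
-- size `k`.
theorem coeff_single_schur (k : ℕ) (lam : YoungDiagram) :
    MvPowerSeries.coeff (Finsupp.single 0 k) (schur K lam) =
      if lam = rowDiagram k then 1 else 0 := by
  have h := pathElem_add_single (K := K) isSteps_stripStep 0 (M := 0) rfl k
  rw [zero_add, pathElem_zero, one_mul] at h
  rw [coeff_schur, h, stepElem_apply isSteps_stripStep]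
  congr 1
  rw [eq_iff_iff, StripStep, isStrip_bot_iff]
  have h0 : (⊥ : YoungDiagram).card = 0 := rfl
  rw [h0, zero_add]
  constructor
  · rintro ⟨-, h1, rfl⟩
    exact h1
  · rintro rfl
    rw [card_rowDiagram]
    exact ⟨bot_le, rfl, rfl⟩

open Classical in
-- Subdiagrams of a row are rows, so only one intermediate diagram contributes to the recursion.
-- This identifies the Schur function of a row with a complete homogeneous function.
theorem coeff_schur_rowDiagram (n : ℕ →₀ ℕ) (m : ℕ) :
    MvPowerSeries.coeff n (schur K (rowDiagram m)) = if n.degree = m then 1 else 0 := by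
  rw [coeff_schur]
  induction n using Finsupp.induction_on_max generalizing m with
  | zero =>
    rw [pathElem_zero, IncidenceAlgebra.one_apply, map_zero]
    congr 1
    rw [eq_iff_iff]
    have h0 : rowDiagram 0 = ⊥ := rfl
    rw [← h0, rowDiagram_injective.eq_iff]
  | single_add M k n hM hk ih =>
    have hn : n M = 0 := by
      by_contra h
      exact lt_irrefl _ (hM M (Finsupp.mem_support_iff.mpr h))
    rw [add_comm, pathElem_add_single _ n hn, IncidenceAlgebra.mul_apply, Icc_eq_between]
    have hterm : ∀ nu ∈ between ⊥ (rowDiagram m), pathElem K isSteps_stripStep n ⊥ nu *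
        stepElem K StripStep k nu (rowDiagram m) =
        if n.degree + k = m ∧ nu = rowDiagram n.degree then 1 else 0 := by
      intro nu hnu
      have h1 := (mem_between.mp hnu).2
      have h2 := eq_rowDiagram_of_le h1
      conv_lhs => rw [h2]
      rw [ih, stepElem_apply isSteps_stripStep, StripStep, card_rowDiagram, card_rowDiagram]
      have h3 : IsStrip (rowDiagram m) (rowDiagram nu.card) := by
        have : IsStrip (rowDiagram m) ⊥ := by rw [isStrip_bot_iff, card_rowDiagram]
        exact fun j => (this j).trans (Nat.add_le_add_right
          (le_iff_colLen_le.mp bot_le j) 1)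
      have h4 : nu = rowDiagram n.degree ↔ n.degree = nu.card := by
        constructor
        · intro h
          rw [h, card_rowDiagram]
        · intro h
          rw [h]
          exact h2
      have h5 : rowDiagram nu.card ≤ rowDiagram m := h2 ▸ h1
      rw [h4]
      by_cases h6 : n.degree = nu.card
      · rw [if_pos h6, one_mul, h6]
        congr 1
        rw [eq_iff_iff]
        constructor
        · rintro ⟨-, -, h⟩
          exact ⟨h.symm, rfl⟩
        · rintro ⟨h, -⟩
          exact ⟨h5, h3, h.symm⟩
      · rw [if_neg h6, zero_mul, if_neg fun h => h6 h.2]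
    rw [Finset.sum_congr rfl hterm, map_add, Finsupp.degree_single]
    by_cases h : n.degree + k = m
    · rw [if_pos h, Finset.sum_eq_single (rowDiagram n.degree), if_pos ⟨h, rfl⟩]
      · intro b _ hb
        rw [if_neg fun h' => hb h'.2]
      · intro h'
        exact absurd (mem_between.mpr ⟨bot_le, rowDiagram_mono (by omega)⟩) h'
    · rw [if_neg h]
      exact Finset.sum_eq_zero fun nu _ => if_neg fun h' => h h'.1

open Classical in
theorem schurCoeff_H (t : K) (lam : YoungDiagram) :
    schurCoeff (H t : MvPowerSeries ℕ K) lam =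
      if lam = rowDiagram lam.card then t ^ lam.card else 0 := by
  have h : schurSum (fun lam => if lam = rowDiagram lam.card then t ^ lam.card else 0) =
      (H t : MvPowerSeries ℕ K) := by
    ext n
    change _ = MvPowerSeries.coeff n (completeSeries t)
    rw [coeff_schurSum, completeSeries_coeff, Finset.sum_eq_single (rowDiagram n.degree)]
    · rw [card_rowDiagram, if_pos rfl, coeff_schur_rowDiagram, if_pos rfl, mul_one]
    · intro lam hlam hne
      rw [mem_ofCard] at hlam
      rw [if_neg (hlam ▸ hne), zero_mul]
    · intro h
      exact absurd (mem_ofCard.mpr (card_rowDiagram _)) h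
  rw [← h, schurCoeff_schurSum]

theorem schurCoeff_rowDiagram {f : MvPowerSeries ℕ K} (hf : f ∈ SymSeries K) (k : ℕ) :
    schurCoeff f (rowDiagram k) = MvPowerSeries.coeff (Finsupp.single 0 k) f := by
  conv_rhs => rw [← schurSum_schurCoeff hf]
  rw [coeff_schurSum, Finset.sum_eq_single (rowDiagram k)]
  · rw [coeff_single_schur, if_pos rfl, mul_one]
  · intro lam _ hne
    rw [coeff_single_schur, if_neg hne, mul_zero]
  · intro h
    exact absurd (mem_ofCard.mpr (by rw [card_rowDiagram, Finsupp.degree_single])) h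

/-- Pairing with H(t) is the evaluation f(t, 0, 0, …): only one-row Schur coefficients of `f` count,
and these are its coefficients at the powers of the first variable. -/
theorem hall_H (t : K) (f : Sym K) {d : ℕ} (hd : ∀ n : ℕ →₀ ℕ, d < n.degree →
    MvPowerSeries.coeff n (f : MvPowerSeries ℕ K) = 0) :
    hall (H t) f = ∑ k ∈ Finset.range (d + 1),
      t ^ k * MvPowerSeries.coeff (Finsupp.single 0 k) (f : MvPowerSeries ℕ K) := by
  classical
  rw [hall, finsum_eq_sum_of_support_subset (s := (Finset.range (d + 1)).image rowDiagram),
    Finset.sum_image rowDiagram_injective.injOn]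
  · refine Finset.sum_congr rfl fun k _ => ?_
    rw [schurCoeff_H, card_rowDiagram, if_pos rfl, schurCoeff_rowDiagram f.2.1]
  · intro lam h
    rw [Finset.mem_coe, Finset.mem_image]
    rw [Function.mem_support, schurCoeff_H] at h
    by_cases h1 : lam = rowDiagram lam.card
    · refine ⟨lam.card, ?_, h1.symm⟩
      rw [Finset.mem_range]
      by_contra! hlt
      exact h (by rw [schurCoeff_eq_zero f.2.1 hd (by omega), mul_zero])
    · rw [if_neg h1, zero_mul] at h
      exact absurd rfl h

end CompleteHall

/-! ### Substitution for the first variable -/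

section Substitution

variable {K : Type*} [CommRing K]

/-- The coefficients of a symmetric power series do not depend on the positions of the
variables. -/
theorem coeff_mapDomain_eq {f : MvPowerSeries ℕ K} (hf : f ∈ SymSeries K) {α : Type*}
    (m : α →₀ ℕ) {e₁ e₂ : α → ℕ} (h₁ : Set.InjOn e₁ m.support) (h₂ : Set.InjOn e₂ m.support) :
    MvPowerSeries.coeff (m.mapDomain e₁) f = MvPowerSeries.coeff (m.mapDomain e₂) f := by
  let φ := m.support.equivFin.symm
  let j₁ : Fin m.support.card ↪ ℕ := ⟨fun i => e₁ (φ i), fun a b h =>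
    φ.injective (Subtype.ext (h₁ (φ a).2 (φ b).2 h))⟩
  let j₂ : Fin m.support.card ↪ ℕ := ⟨fun i => e₂ (φ i), fun a b h =>
    φ.injective (Subtype.ext (h₂ (φ a).2 (φ b).2 h))⟩
  -- Permutations of ℕ act transitively on injective tuples of any finite length, so one permutation
  -- matches `e₁` with `e₂` on the support.
  obtain ⟨σ, hσ⟩ := MulAction.isMultiplyPretransitive_iff.mp
    (Equiv.Perm.isMultiplyPretransitive ℕ m.support.card) j₁ j₂
  rw [← mem_symSeries_iff.mp hf σ, ← Finsupp.mapDomain_comp]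
  congr 2
  refine Finsupp.mapDomain_congr fun x hx => ?_
  have h := DFunLike.congr_fun hσ (φ.symm ⟨x, hx⟩)
  have h1 : j₁ (φ.symm ⟨x, hx⟩) = e₁ x := by
    change e₁ (φ (φ.symm ⟨x, hx⟩)) = e₁ x
    rw [Equiv.apply_symm_apply]
  have h2 : j₂ (φ.symm ⟨x, hx⟩) = e₂ x := by
    change e₂ (φ (φ.symm ⟨x, hx⟩)) = e₂ x
    rw [Equiv.apply_symm_apply]
  rw [← h2, ← h, Function.comp_apply, ← h1]
  rfl

/-- The exponent with first entry `k` and further entries `n`. -/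
noncomputable def consExp (k : ℕ) (n : ℕ →₀ ℕ) : ℕ →₀ ℕ :=
  Finsupp.single 0 k + n.mapDomain Nat.succ

theorem consExp_zero_apply (k : ℕ) (n : ℕ →₀ ℕ) : consExp k n 0 = k := by
  rw [consExp, Finsupp.add_apply, Finsupp.single_eq_same,
    Finsupp.mapDomain_of_notMem_range _ _ (by simp), add_zero]

theorem consExp_succ_apply (k : ℕ) (n : ℕ →₀ ℕ) (i : ℕ) : consExp k n (i + 1) = n i := by
  rw [consExp, Finsupp.add_apply, Finsupp.single_eq_of_ne (Nat.succ_ne_zero i), zero_add]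
  exact Finsupp.mapDomain_apply Nat.succ_injective n i

theorem degree_consExp (k : ℕ) (n : ℕ →₀ ℕ) : (consExp k n).degree = k + n.degree := by
  rw [consExp, map_add, Finsupp.degree_single, Finsupp.degree_mapDomain]

theorem consExp_add (k l : ℕ) (m n : ℕ →₀ ℕ) :
    consExp (k + l) (m + n) = consExp k m + consExp l n := by
  rw [consExp, consExp, consExp, Finsupp.single_add, Finsupp.mapDomain_add]
  abel

theorem consExp_inj {k l : ℕ} {m n : ℕ →₀ ℕ} (h : consExp k m = consExp l n) :
    k = l ∧ m = n := by
  constructor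
  · rw [← consExp_zero_apply k m, h, consExp_zero_apply]
  · ext i
    rw [← consExp_succ_apply k m, h, consExp_succ_apply]

theorem exists_consExp (p : ℕ →₀ ℕ) : ∃ k n, p = consExp k n := by
  refine ⟨p 0, p.comapDomain Nat.succ Nat.succ_injective.injOn, ?_⟩
  ext i
  cases i with
  | zero => rw [consExp_zero_apply]
  | succ i => rw [consExp_succ_apply, Finsupp.comapDomain_apply]

theorem sum_antidiagonal_consExp {M : Type*} [AddCommMonoid M] (k : ℕ) (n : ℕ →₀ ℕ)
    (F : (ℕ →₀ ℕ) → (ℕ →₀ ℕ) → M) :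
    ∑ p ∈ Finset.HasAntidiagonal.antidiagonal (consExp k n), F p.1 p.2 =
      ∑ q ∈ Finset.HasAntidiagonal.antidiagonal n, ∑ r ∈ Finset.HasAntidiagonal.antidiagonal k,
        F (consExp r.1 q.1) (consExp r.2 q.2) := by
  rw [← Finset.sum_product']
  symm
  refine Finset.sum_bij (fun p _ => (consExp p.2.1 p.1.1, consExp p.2.2 p.1.2)) ?_ ?_ ?_ ?_
  · rintro ⟨⟨a, b⟩, ⟨i, j⟩⟩ h
    simp only [Finset.mem_product, Finset.HasAntidiagonal.mem_antidiagonal] at h ⊢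
    rw [← consExp_add, h.1, h.2]
  · rintro ⟨⟨a, b⟩, ⟨i, j⟩⟩ _ ⟨⟨a', b'⟩, ⟨i', j'⟩⟩ _ h
    simp only [Prod.mk.injEq] at h ⊢
    have h1 := consExp_inj h.1
    have h2 := consExp_inj h.2
    exact ⟨⟨h1.2, h2.2⟩, h1.1, h2.1⟩
  · rintro ⟨p, q⟩ h
    obtain ⟨i, a, rfl⟩ := exists_consExp p
    obtain ⟨j, b, rfl⟩ := exists_consExp q
    rw [Finset.HasAntidiagonal.mem_antidiagonal] at h
    simp only at h
    rw [← consExp_add] at h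
    have h1 := consExp_inj h
    refine ⟨((a, b), (i, j)), ?_, rfl⟩
    simp only [Finset.mem_product, Finset.HasAntidiagonal.mem_antidiagonal]
    exact ⟨h1.2, h1.1⟩
  · rintro _ _
    rfl

theorem coeff_consExp_mapDomain {f : MvPowerSeries ℕ K} (hf : f ∈ SymSeries K) (k : ℕ)
    (n : ℕ →₀ ℕ) {α : Type*} (i : α) (m : α →₀ ℕ) {j : ℕ → α} (hj : Function.Injective j)
    (hi : ∀ x, j x ≠ i) (hm : m = Finsupp.single i k + n.mapDomain j) {e : α → ℕ}
    (he : Function.Injective e) :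
    MvPowerSeries.coeff (m.mapDomain e) f = MvPowerSeries.coeff (consExp k n) f := by
  -- A common source for both exponents: one distinguished variable `none` and a copy of ℕ. Each
  -- side is the image of `p` under an injection into ℕ.
  let p : Option ℕ →₀ ℕ := Finsupp.single none k + n.mapDomain some
  have h1 : m.mapDomain e = p.mapDomain (fun o => o.elim (e i) (e ∘ j)) := by
    rw [hm, Finsupp.mapDomain_add, Finsupp.mapDomain_add, Finsupp.mapDomain_single,
      Finsupp.mapDomain_single, ← Finsupp.mapDomain_comp, ← Finsupp.mapDomain_comp]
    rfl
  have h2 : consExp k n = p.mapDomain (fun o => o.elim 0 Nat.succ) := by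
    rw [consExp, Finsupp.mapDomain_add, Finsupp.mapDomain_single, ← Finsupp.mapDomain_comp]
    rfl
  rw [h1, h2]
  refine coeff_mapDomain_eq hf p (Function.Injective.injOn ?_) (Function.Injective.injOn ?_)
  · rintro (_ | a) (_ | b) h
    · rfl
    · exact absurd (he h).symm (hi b)
    · exact absurd (he h) (hi a)
    · exact congrArg some (hj (he h))
  · rintro (_ | a) (_ | b) h
    · rfl
    · exact absurd h.symm (Nat.succ_ne_zero b)
    · exact absurd h (Nat.succ_ne_zero a)
    · exact congrArg some (Nat.succ_injective h)

theorem coeff_consExp_zero {f : MvPowerSeries ℕ K} (hf : f ∈ SymSeries K) (n : ℕ →₀ ℕ) :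
    MvPowerSeries.coeff (consExp 0 n) f = MvPowerSeries.coeff n f := by
  rw [consExp, Finsupp.single_zero, zero_add,
    coeff_mapDomain_eq hf n (e₂ := id) Nat.succ_injective.injOn Function.injective_id.injOn,
    Finsupp.mapDomain_id]

/-- The cutoff `M` is left free above the degree bound so that several series can share one range.
-/
theorem coeff_substFirst (t : K) {f : MvPowerSeries ℕ K} {d M : ℕ}
    (hd : ∀ n : ℕ →₀ ℕ, d < n.degree → MvPowerSeries.coeff n f = 0) (hM : d < M)
    (n : ℕ →₀ ℕ) :
    MvPowerSeries.coeff n (substFirst t f) =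
      ∑ k ∈ Finset.range M, t ^ k * MvPowerSeries.coeff (consExp k n) f := by
  refine finsum_eq_sum_of_support_subset _ fun k hk => ?_
  rw [Finset.mem_coe, Finset.mem_range]
  by_contra! h
  refine hk ?_
  have := hd (consExp k n) (by rw [degree_consExp]; omega)
  rw [consExp] at this
  simp only [this, mul_zero]

theorem substFirst_mem (t : K) (f : Sym K) : substFirst t (f : MvPowerSeries ℕ K) ∈ Sym K := by
  obtain ⟨hf, d, hd⟩ := f.2
  refine ⟨mem_symSeries_iff.mpr fun σ n => ?_, d, fun n hn => ?_⟩
  · rw [coeff_substFirst t hd d.lt_succ_self, coeff_substFirst t hd d.lt_succ_self]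
    refine Finset.sum_congr rfl fun k _ => ?_
    congr 1
    rw [← coeff_consExp_mapDomain hf k n 0 (consExp k (n.mapDomain σ)) (j := Nat.succ ∘ σ)
      (Nat.succ_injective.comp σ.injective) (fun x => Nat.succ_ne_zero _)
      (by rw [consExp, Finsupp.mapDomain_comp]) Function.injective_id, Finsupp.mapDomain_id]
  · rw [coeff_substFirst t hd d.lt_succ_self]
    refine Finset.sum_eq_zero fun k _ => ?_
    rw [hd _ (by rw [degree_consExp]; omega), mul_zero]

theorem substFirst_mul (t : K) (f g : Sym K) :
    substFirst t ((f : MvPowerSeries ℕ K) * g) =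
      substFirst t (f : MvPowerSeries ℕ K) * substFirst t (g : MvPowerSeries ℕ K) := by
  classical
  obtain ⟨-, d, hd⟩ := f.2
  obtain ⟨-, e, he⟩ := g.2
  obtain ⟨-, d', hd'⟩ := (f * g).2
  rw [Subalgebra.coe_mul] at hd'
  set M := d + e + d' + 1 with hM
  -- `P f n` is the coefficient of x^n in f(T, x_1, …) with an indeterminate T for `t`.
  -- Multiplicativity is a convolution identity for these polynomials, which is then evaluated at
  -- `t`.
  let P (f : MvPowerSeries ℕ K) (n : ℕ →₀ ℕ) : Polynomial K :=
    ∑ k ∈ Finset.range M, Polynomial.monomial k (MvPowerSeries.coeff (consExp k n) f)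
  have hP : ∀ {f : MvPowerSeries ℕ K} {d : ℕ},
      (∀ n : ℕ →₀ ℕ, d < n.degree → MvPowerSeries.coeff n f = 0) → d < M → ∀ n k,
      (P f n).coeff k = MvPowerSeries.coeff (consExp k n) f := by
    intro f d hd hdM n k
    simp only [P, Polynomial.finsetSum_coeff, Polynomial.coeff_monomial, Finset.sum_ite_eq',
      Finset.mem_range]
    split_ifs with h
    · rfl
    · rw [hd _ (by rw [degree_consExp]; omega)]
  have hev : ∀ {f : MvPowerSeries ℕ K} {d : ℕ},
      (∀ n : ℕ →₀ ℕ, d < n.degree → MvPowerSeries.coeff n f = 0) → d < M → ∀ n,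
      MvPowerSeries.coeff n (substFirst t f) = (P f n).eval t := by
    intro f d hd hdM n
    rw [coeff_substFirst t hd hdM, Polynomial.eval_finsetSum]
    refine Finset.sum_congr rfl fun k _ => ?_
    rw [Polynomial.eval_monomial, mul_comm]
  ext n
  rw [hev hd' (by omega), MvPowerSeries.coeff_mul]
  have key : P ((f : MvPowerSeries ℕ K) * g) n =
      ∑ q ∈ Finset.HasAntidiagonal.antidiagonal n, P f q.1 * P g q.2 := by
    ext k
    rw [hP hd' (by omega), MvPowerSeries.coeff_mul, sum_antidiagonal_consExp k n
      (fun a b => MvPowerSeries.coeff a (f : MvPowerSeries ℕ K) *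
        MvPowerSeries.coeff b (g : MvPowerSeries ℕ K)), Polynomial.finsetSum_coeff]
    refine Finset.sum_congr rfl fun q _ => ?_
    rw [Polynomial.coeff_mul]
    refine Finset.sum_congr rfl fun r _ => ?_
    rw [hP hd (by omega), hP he (by omega)]
  rw [key, Polynomial.eval_finsetSum]
  refine Finset.sum_congr rfl fun q _ => ?_
  rw [Polynomial.eval_mul, hev hd (by omega), hev he (by omega)]

/-- The substitution `f ↦ f(t, x₁, x₂, …)` as an algebra homomorphism of symmetric functions. -/
noncomputable def substHom (t : K) : Sym K →ₐ[K] Sym K :=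
  AlgHom.ofLinearMap
    { toFun := fun f => ⟨substFirst t (f : MvPowerSeries ℕ K), substFirst_mem t f⟩
      map_add' := by
        intro f g
        obtain ⟨-, d, hd⟩ := f.2
        obtain ⟨-, e, he⟩ := g.2
        refine Subtype.ext (MvPowerSeries.ext fun n => ?_)
        change MvPowerSeries.coeff n (substFirst t ((f : MvPowerSeries ℕ K) + (g : MvPowerSeries ℕ K))) =
          MvPowerSeries.coeff n (substFirst t (f : MvPowerSeries ℕ K)) +
            MvPowerSeries.coeff n (substFirst t (g : MvPowerSeries ℕ K))
        have hde : ∀ n : ℕ →₀ ℕ, d + e < n.degree →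
            MvPowerSeries.coeff n ((f : MvPowerSeries ℕ K) + (g : MvPowerSeries ℕ K)) = 0 := fun n hn => by
          rw [map_add, hd n (by omega), he n (by omega), add_zero]
        rw [coeff_substFirst t hd (show d < d + e + 1 by omega),
          coeff_substFirst t he (show e < d + e + 1 by omega),
          coeff_substFirst t hde (show d + e < d + e + 1 by omega), ← Finset.sum_add_distrib]
        exact Finset.sum_congr rfl fun k _ => by rw [map_add, mul_add]
      map_smul' := by
        intro r f
        obtain ⟨-, d, hd⟩ := f.2
        refine Subtype.ext (MvPowerSeries.ext fun n => ?_)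
        change MvPowerSeries.coeff n (substFirst t (r • (f : MvPowerSeries ℕ K))) =
          MvPowerSeries.coeff n (r • substFirst t (f : MvPowerSeries ℕ K))
        have hd' : ∀ n : ℕ →₀ ℕ, d < n.degree →
            MvPowerSeries.coeff n (r • (f : MvPowerSeries ℕ K)) = 0 := fun n hn => by
          rw [map_smul, hd n hn, smul_zero]
        rw [map_smul, coeff_substFirst t hd d.lt_succ_self,
          coeff_substFirst t hd' d.lt_succ_self, Finset.smul_sum]
        exact Finset.sum_congr rfl fun k _ => by
          rw [map_smul, smul_eq_mul, smul_eq_mul, mul_left_comm] }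
    (by
      classical
      refine Subtype.ext (MvPowerSeries.ext fun n => ?_)
      change MvPowerSeries.coeff n (substFirst t (1 : MvPowerSeries ℕ K)) =
        MvPowerSeries.coeff n (1 : MvPowerSeries ℕ K)
      have hd : ∀ n : ℕ →₀ ℕ, 0 < n.degree →
          MvPowerSeries.coeff n (1 : MvPowerSeries ℕ K) = 0 := fun n hn => by
        rw [MvPowerSeries.coeff_one, if_neg]
        rintro rfl
        simp at hn
      rw [coeff_substFirst t hd Nat.zero_lt_one, Finset.sum_range_one, pow_zero, one_mul,
        coeff_consExp_zero (one_mem _)])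
    (fun f g => Subtype.ext (substFirst_mul t f g))

theorem coe_substHom (t : K) (f : Sym K) :
    (substHom t f : MvPowerSeries ℕ K) = substFirst t (f : MvPowerSeries ℕ K) := rfl

/-- The substitution preserves the components of highest degree. -/
theorem coeff_substHom_sub (t : K) {f : Sym K} {d : ℕ}
    (hf : ∀ n : ℕ →₀ ℕ, d + 1 ≤ n.degree →
      MvPowerSeries.coeff n (f : MvPowerSeries ℕ K) = 0) (n : ℕ →₀ ℕ) (hn : d ≤ n.degree) :
    MvPowerSeries.coeff n ((substHom t f - f : Sym K) : MvPowerSeries ℕ K) = 0 := by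
  rw [Subalgebra.coe_sub, map_sub, coe_substHom, coeff_substFirst t hf d.lt_succ_self,
    Finset.sum_range_succ', Finset.sum_eq_zero, zero_add, pow_zero, one_mul,
    coeff_consExp_zero f.2.1, sub_self]
  intro k _
  rw [hf _ (by rw [degree_consExp]; omega), mul_zero]

/-- On an element of the kernel, the difference `substHom t f - f` is `-f`, so the degree bound of
`f` can be lowered until nothing remains. -/
theorem substHom_injective (t : K) : Function.Injective (substHom t) := by
  rw [injective_iff_map_eq_zero]
  intro f h0
  have key : ∀ d, (∀ n : ℕ →₀ ℕ, d ≤ n.degree →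
      MvPowerSeries.coeff n (f : MvPowerSeries ℕ K) = 0) → f = 0 := by
    intro d
    induction d with
    | zero =>
      intro h
      refine Subtype.ext (MvPowerSeries.ext fun n => ?_)
      rw [h n (Nat.zero_le _)]
      rfl
    | succ d ih =>
      intro h
      refine ih fun n hn => ?_
      have := coeff_substHom_sub t h n hn
      rw [h0, zero_sub, Subalgebra.coe_neg, map_neg, neg_eq_zero] at this
      exact this
  obtain ⟨-, d, hd⟩ := f.2
  exact key (d + 1) fun n hn => hd n (by omega)

theorem substHom_surjective (t : K) : Function.Surjective (substHom t) := by
  have key : ∀ d (f : Sym K), (∀ n : ℕ →₀ ℕ, d ≤ n.degree →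
      MvPowerSeries.coeff n (f : MvPowerSeries ℕ K) = 0) → ∃ g, substHom t g = f := by
    intro d
    induction d with
    | zero =>
      intro f h
      refine ⟨0, ?_⟩
      rw [map_zero]
      refine Subtype.ext (MvPowerSeries.ext fun n => ?_)
      rw [h n (Nat.zero_le _)]
      rfl
    | succ d ih =>
      intro f h
      obtain ⟨g, hg⟩ := ih (substHom t f - f) (coeff_substHom_sub t h)
      -- The error `substHom t f - f` has smaller degree, so it is the image of some `g`;
      -- subtracting `g` from `f` corrects it.
      exact ⟨f - g, by rw [map_sub, hg, sub_sub_cancel]⟩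
  intro f
  obtain ⟨-, d, hd⟩ := f.2
  exact key (d + 1) f fun n hn => hd n (by omega)

end Substitution

/-! ### The coproduct -/

section CoproductExists

variable {K : Type*} [CommRing K]

/-- The exponent of the monomial `x^a y^b` in two alphabets. -/
noncomputable def joinExp (a b : ℕ →₀ ℕ) : ℕ ⊕ ℕ →₀ ℕ :=
  a.mapDomain Sum.inl + b.mapDomain Sum.inr

theorem joinExp_inl (a b : ℕ →₀ ℕ) (i : ℕ) : joinExp a b (Sum.inl i) = a i := by
  rw [joinExp, Finsupp.add_apply, Finsupp.mapDomain_apply Sum.inl_injective,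
    Finsupp.mapDomain_of_notMem_range _ _ (by simp), add_zero]

theorem joinExp_inr (a b : ℕ →₀ ℕ) (i : ℕ) : joinExp a b (Sum.inr i) = b i := by
  rw [joinExp, Finsupp.add_apply, Finsupp.mapDomain_apply Sum.inr_injective,
    Finsupp.mapDomain_of_notMem_range _ _ (by simp), zero_add]

theorem exists_joinExp (p : ℕ ⊕ ℕ →₀ ℕ) : ∃ a b, p = joinExp a b := by
  refine ⟨p.comapDomain Sum.inl Sum.inl_injective.injOn,
    p.comapDomain Sum.inr Sum.inr_injective.injOn, ?_⟩
  ext (i | i)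
  · rw [joinExp_inl, Finsupp.comapDomain_apply]
  · rw [joinExp_inr, Finsupp.comapDomain_apply]

theorem degree_joinExp (a b : ℕ →₀ ℕ) : (joinExp a b).degree = a.degree + b.degree := by
  rw [joinExp, map_add, Finsupp.degree_mapDomain, Finsupp.degree_mapDomain]

theorem coeff_joinExp_mul (p q : MvPowerSeries ℕ K) (a b : ℕ →₀ ℕ) :
    MvPowerSeries.coeff (joinExp a b)
      (MvPowerSeries.rename (R := K) (Function.Embedding.inl : ℕ ↪ ℕ ⊕ ℕ) p *
        MvPowerSeries.rename (R := K) (Function.Embedding.inr : ℕ ↪ ℕ ⊕ ℕ) q) =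
      MvPowerSeries.coeff a p * MvPowerSeries.coeff b q := by
  classical
  have h1 := MvPowerSeries.coeff_embDomain_rename (Function.Embedding.inl : ℕ ↪ ℕ ⊕ ℕ) p a
  have h2 := MvPowerSeries.coeff_embDomain_rename (Function.Embedding.inr : ℕ ↪ ℕ ⊕ ℕ) q b
  rw [Finsupp.embDomain_eq_mapDomain] at h1 h2
  rw [MvPowerSeries.coeff_mul, Finset.sum_eq_single (a.mapDomain Sum.inl, b.mapDomain Sum.inr)]
  · exact congrArg₂ (· * ·) h1 h2
  · rintro ⟨u, v⟩ huv hne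
    rw [Finset.HasAntidiagonal.mem_antidiagonal] at huv
    simp only at huv ⊢
    by_cases hu : u ∈ Set.range (Finsupp.mapDomain (M := ℕ)
        (Function.Embedding.inl : ℕ ↪ ℕ ⊕ ℕ))
    · by_cases hv : v ∈ Set.range (Finsupp.mapDomain (M := ℕ)
          (Function.Embedding.inr : ℕ ↪ ℕ ⊕ ℕ))
      · obtain ⟨a', rfl⟩ := hu
        obtain ⟨b', rfl⟩ := hv
        have huv' : joinExp a' b' = joinExp a b := huv
        refine absurd ?_ hne
        have ha : a' = a := by
          ext i
          rw [← joinExp_inl a' b', huv', joinExp_inl]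
        have hb : b' = b := by
          ext i
          rw [← joinExp_inr a' b', huv', joinExp_inr]
        rw [ha, hb]
        rfl
      · have h0 : MvPowerSeries.coeff v (MvPowerSeries.rename (R := K)
            (Function.Embedding.inr : ℕ ↪ ℕ ⊕ ℕ) q) = 0 :=
          MvPowerSeries.coeff_rename_eq_zero _ q hv
        rw [h0, mul_zero]
    · have h0 : MvPowerSeries.coeff u (MvPowerSeries.rename (R := K)
          (Function.Embedding.inl : ℕ ↪ ℕ ⊕ ℕ) p) = 0 :=
        MvPowerSeries.coeff_rename_eq_zero _ p hu
      rw [h0, zero_mul]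
  · intro h
    rw [Finset.HasAntidiagonal.mem_antidiagonal] at h
    exact absurd (joinExp.eq_1 a b).symm h

theorem tensorToSeries_tmul (p q : Sym K) :
    tensorToSeries K (p ⊗ₜ q) =
      MvPowerSeries.rename (R := K) (Function.Embedding.inl : ℕ ↪ ℕ ⊕ ℕ) (p : MvPowerSeries ℕ K) *
      MvPowerSeries.rename (R := K) (Function.Embedding.inr : ℕ ↪ ℕ ⊕ ℕ) (q : MvPowerSeries ℕ K) :=
  rfl

theorem coeff_twoAlphabets (f : MvPowerSeries ℕ K) (p : ℕ ⊕ ℕ →₀ ℕ) :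
    MvPowerSeries.coeff p (twoAlphabets f) =
      MvPowerSeries.coeff (p.mapDomain Equiv.natSumNatEquivNat) f := by
  rw [← coeff_rename_equiv Equiv.natSumNatEquivNat.symm f, ← Finsupp.mapDomain_comp,
    Equiv.symm_comp_self, Finsupp.mapDomain_id]
  rfl

/-- The coefficient of `y^b` in `f(x, y)`. -/
noncomputable def sliceSeries (f : MvPowerSeries ℕ K) (b : ℕ →₀ ℕ) : MvPowerSeries ℕ K :=
  fun a => MvPowerSeries.coeff (joinExp a b) (twoAlphabets f)

theorem coeff_sliceSeries (f : MvPowerSeries ℕ K) (a b : ℕ →₀ ℕ) :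
    MvPowerSeries.coeff a (sliceSeries f b) =
      MvPowerSeries.coeff (joinExp a b) (twoAlphabets f) := rfl

theorem coeff_twoAlphabets_mapDomain {f : MvPowerSeries ℕ K} (hf : f ∈ SymSeries K)
    (σ τ : Equiv.Perm ℕ) (a b : ℕ →₀ ℕ) :
    MvPowerSeries.coeff (joinExp (a.mapDomain σ) (b.mapDomain τ)) (twoAlphabets f) =
      MvPowerSeries.coeff (joinExp a b) (twoAlphabets f) := by
  have h : joinExp (a.mapDomain σ) (b.mapDomain τ) =
      (joinExp a b).mapDomain (Equiv.sumCongr σ τ) := by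
    rw [joinExp, joinExp, Finsupp.mapDomain_add, ← Finsupp.mapDomain_comp,
      ← Finsupp.mapDomain_comp, ← Finsupp.mapDomain_comp, ← Finsupp.mapDomain_comp]
    rfl
  rw [coeff_twoAlphabets, coeff_twoAlphabets, h, ← Finsupp.mapDomain_comp]
  exact coeff_mapDomain_eq hf _
    ((Equiv.natSumNatEquivNat.injective.comp (Equiv.sumCongr σ τ).injective).injOn)
    Equiv.natSumNatEquivNat.injective.injOn

/-- Permuting only the first alphabet is still an injective relabelling of all variables. -/
theorem sliceSeries_mem {f : MvPowerSeries ℕ K} (hf : f ∈ SymSeries K) (b : ℕ →₀ ℕ) :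
    sliceSeries f b ∈ SymSeries K := by
  refine mem_symSeries_iff.mpr fun σ a => ?_
  rw [coeff_sliceSeries, coeff_sliceSeries]
  have := coeff_twoAlphabets_mapDomain hf σ 1 a b
  rwa [Equiv.Perm.coe_one, Finsupp.mapDomain_id] at this

theorem sliceSeries_mapDomain {f : MvPowerSeries ℕ K} (hf : f ∈ SymSeries K)
    (σ : Equiv.Perm ℕ) (b : ℕ →₀ ℕ) : sliceSeries f (b.mapDomain σ) = sliceSeries f b := by
  ext a
  rw [coeff_sliceSeries, coeff_sliceSeries]
  have := coeff_twoAlphabets_mapDomain hf 1 σ a b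
  rwa [Equiv.Perm.coe_one, Finsupp.mapDomain_id] at this

theorem coeff_sliceSeries_eq_zero {f : MvPowerSeries ℕ K} {d : ℕ}
    (hd : ∀ n : ℕ →₀ ℕ, d < n.degree → MvPowerSeries.coeff n f = 0) (a b : ℕ →₀ ℕ)
    (h : d < a.degree + b.degree) : MvPowerSeries.coeff a (sliceSeries f b) = 0 := by
  rw [coeff_sliceSeries, coeff_twoAlphabets, hd]
  rw [Finsupp.degree_mapDomain, degree_joinExp]
  exact h

theorem schurCoeff_zero : schurCoeff (0 : MvPowerSeries ℕ K) = 0 := by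
  have := schurCoeff_smul (0 : K) (zero_mem (SymSeries K))
  rwa [zero_smul, zero_smul] at this

/-- The coefficient of `s_λ(x)` in `f(x, y)`. -/
noncomputable def schurSlice (f : Sym K) (lam : YoungDiagram) : Sym K :=
  ⟨fun b => schurCoeff (sliceSeries (f : MvPowerSeries ℕ K) b) lam, by
    obtain ⟨hf, d, hd⟩ := f.2
    refine ⟨mem_symSeries_iff.mpr fun σ b => ?_, d, fun b hb => ?_⟩
    · change schurCoeff (sliceSeries (f : MvPowerSeries ℕ K) (b.mapDomain σ)) lam = _
      rw [sliceSeries_mapDomain hf]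
      rfl
    · change schurCoeff (sliceSeries (f : MvPowerSeries ℕ K) b) lam = 0
      have : sliceSeries (f : MvPowerSeries ℕ K) b = 0 := by
        ext a
        rw [coeff_sliceSeries_eq_zero hd a b (by omega), map_zero]
      rw [this, schurCoeff_zero, Pi.zero_apply]⟩

theorem coeff_schurSlice (f : Sym K) (lam : YoungDiagram) (b : ℕ →₀ ℕ) :
    MvPowerSeries.coeff b (schurSlice f lam : MvPowerSeries ℕ K) =
      schurCoeff (sliceSeries (f : MvPowerSeries ℕ K) b) lam := rfl

/-- For every monomial y^b the coefficient series in x has a Schur expansion. Collecting the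
coefficients of s_λ(x) gives a symmetric function of y, and only diagrams with at most `d` boxes
occur, so the tensor is a finite sum. -/
theorem exists_coproduct (f : Sym K) :
    ∃ T : Sym K ⊗[K] Sym K, tensorToSeries K T = twoAlphabets (f : MvPowerSeries ℕ K) := by
  classical
  obtain ⟨hf, d, hd⟩ := f.2
  refine ⟨∑ lam ∈ (Finset.range (d + 1)).biUnion ofCard,
    ⟨schur K lam, schur_mem lam⟩ ⊗ₜ schurSlice f lam, ?_⟩
  ext p
  obtain ⟨a, b, rfl⟩ := exists_joinExp p
  rw [← coeff_sliceSeries, map_sum, map_sum]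
  conv_rhs => rw [← schurSum_schurCoeff (sliceSeries_mem hf b)]
  have h : MvPowerSeries.coeff a (schurSum (schurCoeff (sliceSeries (f : MvPowerSeries ℕ K) b))) =
      ∑ lam ∈ (Finset.range (d + 1)).biUnion ofCard,
        schurCoeff (sliceSeries (f : MvPowerSeries ℕ K) b) lam *
          MvPowerSeries.coeff a (schur K lam) := by
    refine finsum_eq_sum_of_support_subset _ fun lam hlam => ?_
    rw [Finset.mem_coe, Finset.mem_biUnion]
    refine ⟨lam.card, ?_, mem_ofCard.mpr rfl⟩
    rw [Finset.mem_range]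
    by_contra! hlt
    refine hlam ?_
    simp only [schurCoeff_eq_zero (sliceSeries_mem hf b)
      (fun a ha => coeff_sliceSeries_eq_zero hd a b (by omega)) (show d < lam.card by omega),
      zero_mul]
  rw [h]
  refine Finset.sum_congr rfl fun lam _ => ?_
  rw [tensorToSeries_tmul, coeff_joinExp_mul, coeff_schurSlice, mul_comm]

theorem tensorToSeries_coproduct (f : Sym K) :
    tensorToSeries K (coproduct f) = twoAlphabets (f : MvPowerSeries ℕ K) := by
  rw [coproduct, dif_pos (exists_coproduct f)]
  exact (exists_coproduct f).choose_spec

/-- The result depends on `T` only through its power series, so the choice of the tensor in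
`coproduct` is harmless and no injectivity of `tensorToSeries` is required. Validity for all large
`M` lets two summands share a range. -/
theorem exists_coeff_lid_rTensor_hallLin (t : K) (T : Sym K ⊗[K] Sym K) (n : ℕ →₀ ℕ) :
    ∃ N : ℕ, ∀ M, N ≤ M →
      MvPowerSeries.coeff n ((TensorProduct.lid K (Sym K)
        ((hallLin (H t)).rTensor (Sym K) T) : Sym K) : MvPowerSeries ℕ K) =
      ∑ k ∈ Finset.range M, t ^ k *
        MvPowerSeries.coeff (joinExp (Finsupp.single 0 k) n) (tensorToSeries K T) := by
  induction T with
  | zero =>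
    refine ⟨0, fun M _ => ?_⟩
    rw [map_zero, map_zero, map_zero, Subalgebra.coe_zero, map_zero, Finset.sum_eq_zero]
    intro k _
    rw [map_zero, mul_zero]
  | tmul p q =>
    obtain ⟨-, d, hd⟩ := p.2
    refine ⟨d + 1, fun M hM => ?_⟩
    obtain ⟨M, rfl⟩ : ∃ M', M = M' + 1 := ⟨M - 1, by omega⟩
    rw [LinearMap.rTensor_tmul, TensorProduct.lid_tmul, hallLin_apply,
      hall_H t p (d := M) (fun n hn => hd n (by omega)), Subalgebra.coe_smul, map_smul,
      smul_eq_mul, Finset.sum_mul]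
    refine Finset.sum_congr rfl fun k _ => ?_
    rw [tensorToSeries_tmul, coeff_joinExp_mul, mul_assoc]
  | add S T hS hT =>
    obtain ⟨N₁, h₁⟩ := hS
    obtain ⟨N₂, h₂⟩ := hT
    refine ⟨max N₁ N₂, fun M hM => ?_⟩
    rw [map_add, map_add, map_add, Subalgebra.coe_add, map_add, h₁ M (by omega), h₂ M (by omega),
      ← Finset.sum_add_distrib]
    exact Finset.sum_congr rfl fun k _ => by rw [map_add, mul_add]

/-- Both sides sum t^k times the coefficient of `f` at an exponent with one entry `k` and the
remaining entries `n`; by symmetry it does not matter how the two alphabets are numbered. -/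
theorem perp_H (t : K) (f : Sym K) : perp (H t) f = substHom t f := by
  refine Subtype.ext (MvPowerSeries.ext fun n => ?_)
  obtain ⟨hf, d, hd⟩ := f.2
  obtain ⟨N, hN⟩ := exists_coeff_lid_rTensor_hallLin t (coproduct f) n
  rw [perp, hN (N + d + 1) (by omega), coe_substHom,
    coeff_substFirst t hd (show d < N + d + 1 by omega), tensorToSeries_coproduct]
  refine Finset.sum_congr rfl fun k _ => ?_
  rw [coeff_twoAlphabets, coeff_consExp_mapDomain hf k n (Sum.inl 0)
    (joinExp (Finsupp.single 0 k) n) Sum.inr_injective (by simp)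
    (by rw [joinExp, Finsupp.mapDomain_single]) Equiv.natSumNatEquivNat.injective]

end CoproductExists

/-! ### Substitution in dual stable Grothendieck polynomials -/

section Main

variable {K : Type*} [CommRing K]

theorem numCols_le_card (lam mu : YoungDiagram) : numCols lam mu ≤ lam.card :=
  Finset.card_image_le.trans (Finset.card_le_card Finset.sdiff_subset)

theorem sum_pow_mul_stepElem (t : K) {mu lam : YoungDiagram} (hle : mu ≤ lam) {M : ℕ}
    (hM : lam.card < M) :
    ∑ k ∈ Finset.range M, t ^ k * stepElem K ColStep k mu lam = t ^ numCols lam mu := by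
  rw [Finset.sum_eq_single (numCols lam mu)]
  · rw [stepElem_apply isSteps_colStep, if_pos ⟨hle, rfl⟩, mul_one]
  · intro k _ hk
    rw [stepElem_apply isSteps_colStep, if_neg fun h => hk h.2.symm, mul_zero]
  · intro h
    rw [Finset.mem_range] at h
    exact absurd ((numCols_le_card lam mu).trans_lt hM) h

theorem exists_coeff_substFirst_dualGroth (t : K) {lam mu : YoungDiagram} (hle : mu ≤ lam)
    (n : ℕ →₀ ℕ) : ∃ M, lam.card < M ∧
      MvPowerSeries.coeff n (substFirst t (dualGroth K lam mu)) =
        ∑ k ∈ Finset.range M, t ^ k * pathElem K isSteps_colStep (consExp k n) mu lam := by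
  obtain ⟨-, d, hd⟩ := dualGroth_mem (K := K) hle
  refine ⟨d + lam.card + 1, by omega, ?_⟩
  rw [coeff_substFirst t hd (show d < d + lam.card + 1 by omega)]
  exact Finset.sum_congr rfl fun k _ => by rw [coeff_dualGroth K hle]

theorem consExp_eq_add_single (k : ℕ) (n : ℕ →₀ ℕ) :
    consExp k n = n.mapDomain Nat.succ + Finsupp.single 0 k := add_comm _ _

theorem mapDomain_succ_zero (n : ℕ →₀ ℕ) : n.mapDomain Nat.succ 0 = 0 :=
  Finsupp.mapDomain_of_notMem_range _ _ (by simp)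

/-- The step of the variable replaced by `t` is taken last, from ν to λ; summing over its size `k`
leaves only k = c(λ/ν). -/
theorem substFirst_dualGroth_left (t : K) {lam mu : YoungDiagram} (hle : mu ≤ lam) :
    substFirst t (dualGroth K lam mu) =
      ∑ nu ∈ between mu lam, (t ^ numCols lam nu) • dualGroth K nu mu := by
  classical
  ext n
  obtain ⟨M, hM, h⟩ := exists_coeff_substFirst_dualGroth t hle n
  rw [h, map_sum]
  have h1 : ∀ k ∈ Finset.range M, t ^ k * pathElem K isSteps_colStep (consExp k n) mu lam =
      ∑ nu ∈ between mu lam, pathElem K isSteps_colStep n mu nu *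
        (t ^ k * stepElem K ColStep k nu lam) := by
    intro k _
    rw [consExp_eq_add_single, pathElem_add_single _ _ (mapDomain_succ_zero n),
      pathElem_mapDomain _ Nat.succ_injective, IncidenceAlgebra.mul_apply, Icc_eq_between,
      Finset.mul_sum]
    exact Finset.sum_congr rfl fun nu _ => mul_left_comm _ _ _
  rw [Finset.sum_congr rfl h1, Finset.sum_comm]
  refine Finset.sum_congr rfl fun nu hnu => ?_
  rw [mem_between] at hnu
  rw [← Finset.mul_sum, sum_pow_mul_stepElem t hnu.2 hM, map_smul, coeff_dualGroth K hnu.1,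
    smul_eq_mul, mul_comm]

/-- The step of the variable replaced by `t` is taken first, from μ to ν, which commutativity of the
steps permits. -/
theorem substFirst_dualGroth_right (t : K) {lam mu : YoungDiagram} (hle : mu ≤ lam) :
    substFirst t (dualGroth K lam mu) =
      ∑ nu ∈ between mu lam, (t ^ numCols nu mu) • dualGroth K lam nu := by
  classical
  ext n
  obtain ⟨M, hM, h⟩ := exists_coeff_substFirst_dualGroth t hle n
  rw [h, map_sum]
  have h1 : ∀ k ∈ Finset.range M, t ^ k * pathElem K isSteps_colStep (consExp k n) mu lam =
      ∑ nu ∈ between mu lam, (t ^ k * stepElem K ColStep k mu nu) *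
        pathElem K isSteps_colStep n nu lam := by
    intro k _
    rw [consExp_eq_add_single, pathElem_single_add _ _ (mapDomain_succ_zero n),
      pathElem_mapDomain _ Nat.succ_injective, IncidenceAlgebra.mul_apply, Icc_eq_between,
      Finset.mul_sum]
    exact Finset.sum_congr rfl fun nu _ => (mul_assoc _ _ _).symm
  rw [Finset.sum_congr rfl h1, Finset.sum_comm]
  refine Finset.sum_congr rfl fun nu hnu => ?_
  rw [mem_between] at hnu
  rw [← Finset.sum_mul, sum_pow_mul_stepElem t hnu.1 ((card_mono hnu.2).trans_lt hM), map_smul,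
    coeff_dualGroth K hnu.2, smul_eq_mul]

end Main

end SymFun

theorem mainTheorem8 {K : Type*} [CommRing K] (t : K) :
    ∃ Φ : SymFun.Sym K ≃ₐ[K] SymFun.Sym K,
      (∀ f : SymFun.Sym K, Φ f = SymFun.perp (SymFun.H t) f) ∧
      (∀ f : SymFun.Sym K,
        (Φ f : MvPowerSeries ℕ K) = SymFun.substFirst t (f : MvPowerSeries ℕ K)) ∧
      (∀ lam mu : YoungDiagram, mu ≤ lam →
        ∃ hg : SymFun.dualGroth K lam mu ∈ SymFun.Sym K,
          (Φ ⟨SymFun.dualGroth K lam mu, hg⟩ : MvPowerSeries ℕ K)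
              = ∑ nu ∈ SymFun.between mu lam,
                  (t ^ SymFun.numCols lam nu) • SymFun.dualGroth K nu mu ∧
          (Φ ⟨SymFun.dualGroth K lam mu, hg⟩ : MvPowerSeries ℕ K)
              = ∑ nu ∈ SymFun.between mu lam,
                  (t ^ SymFun.numCols nu mu) • SymFun.dualGroth K lam nu) ∧
      (∀ lam : YoungDiagram,
        ∃ hg : SymFun.dualGroth K lam ⊥ ∈ SymFun.Sym K,
          (Φ ⟨SymFun.dualGroth K lam ⊥, hg⟩ : MvPowerSeries ℕ K)
              = ∑ nu ∈ SymFun.between ⊥ lam,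
                  (t ^ SymFun.numCols lam nu) • SymFun.dualGroth K nu ⊥ ∧
          (Φ ⟨SymFun.dualGroth K lam ⊥, hg⟩ : MvPowerSeries ℕ K)
              = ∑ nu ∈ SymFun.between ⊥ lam,
                  (t ^ SymFun.numCols nu ⊥) • SymFun.dualGroth K lam nu) := by

  refine ⟨AlgEquiv.ofBijective (SymFun.substHom t)
    ⟨SymFun.substHom_injective t, SymFun.substHom_surjective t⟩,
    fun f => (SymFun.perp_H t f).symm, fun f => rfl, fun lam mu hle => ?_, fun lam => ?_⟩
  · exact ⟨SymFun.dualGroth_mem hle, SymFun.substFirst_dualGroth_left t hle,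
      SymFun.substFirst_dualGroth_right t hle⟩
  · exact ⟨SymFun.dualGroth_mem bot_le, SymFun.substFirst_dualGroth_left t bot_le,
      SymFun.substFirst_dualGroth_right t bot_le⟩
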